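/- An ultragraph $\mathcal G=(G^0,\mathcal G^1,r,s)$ consists of countable sets $G^0$ (vertices) and $\mathcal G^1$ (edges), a map $s:\mathcal G^1\to G^0$, and a map $r$ from $\mathcal G^1$ to the nonempty subsets of $G^0$. Let $\mathcal G^0$ be the smallest collection of subsets of $G^0$ that contains $\emptyset$, all $\{v\}$ and all $r(e)$ and is closed under finite unions and intersections. A Cuntz–Krieger $\mathcal G$-family consists of partial isometries $s_e$ ($e\in\mathcal G^1$) with mutually orthogonal ranges and projections $p_A$ ($A\in\mathcal G^0$) such that $p_\emptyset=0$, $p_Ap_B=p_{A\cap B}$, $p_{A\cup B}=p_A+p_B-p_{A\cap B}$, $s_e^*s_e=p_{r(e)}$, $s_es_e^*\le p_{s(e)}$ (writing $p_v=p_{\{v\}}$), and $p_v=\sum_{s(e)=v}s_es_e^*$ whenever $0<|s^{-1}(v)|<\infty$. Let $C^*(\mathcal G)$ be the $C^*$-algebra generated by a universal Cuntz–Krieger $\mathcal G$-family. A vertex $v$ is singular if it is a sink ($s^{-1}(v)=\emptyset$) or an infinite emitter ($s^{-1}(v)$ infinite). A desingularization $\mathcal F$ of $\mathcal G$ is obtained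 by adding a tail at every singular vertex $v$: one adds new vertices $v_1,v_2,\dots$ and edges $e_i$ ($i\ge1$) with $s(e_i)=v_{i-1}$ and $r(e_i)=\{v_i\}$, where $v_0=v$; if $v$ is an infinite emitter, one also lists $s^{-1}(v)=\{g_1,g_2,\dots\}$ without repetition and replaces each $g_j$ by an edge $f_j$ with $s(f_j)=v_{j-1}$ and $r(f_j)=r(g_j)$. Then $\mathcal G^0\subseteq\mathcal F^0$. **Proposition.** Let $\mathcal G$ be an ultragraph and let $\mathcal F$ be a desingularization of $\mathcal G$, with canonical generators $\{t_e,q_A\}$ of $C^*(\mathcal F)$. Let $w_1,w_2,\dots$ and $h_1,h_2,\dots$ be (finite or infinite) lists of all elements of $G^0$ and of $\mathcal G^1$, and put $A_n=\{w_1,\dots,w_n\}\cup\bigcup_{i=1}^n r(h_i)\in\mathcal G^0$ (omitting missing entries). Then the projections $q_{A_n}$ converge strictly to a projection $p$ in the multiplier algebra $\mathcal M(C^*(\mathcal F))$, the corner $pC^*(\mathcal F)p$ is full (it is contained in no proper closed two-sided ideal of $C^*(\mathcal F)$), and $C^*(\mathcal G)\cong pC^*(\mathcal F)p$ as $C^*$-algebras.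 -/

import Mathlib

open scoped ENNReal MultiplierAlgebra Topology
open Filter

universe u

/-- An ultragraph: countable sets of vertices and edges, a source map into the vertices and a
range map into the nonempty sets of vertices. -/
structure Ultragraph where
  V : Type u
  E : Type u
  countable_V : Countable V
  countable_E : Countable E
  s : E → V
  r : E → Set V
  r_nonempty : ∀ e, (r e).Nonempty

namespace Ultragraph

/-- Membership in `𝒢⁰`, the smallest collection of sets of vertices that contains all singletons
and all ranges of edges and is closed under finite unions (including the empty one) and finite
intersections. -/
inductive IsGenSet (G : Ultragraph.{u}) : Set G.V → Prop
  | empty : IsGenSet G ∅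
  | singleton (v : G.V) : IsGenSet G {v}
  | range (e : G.E) : IsGenSet G (G.r e)
  | inter {A B : Set G.V} : IsGenSet G A → IsGenSet G B → IsGenSet G (A ∩ B)
  | union {A B : Set G.V} : IsGenSet G A → IsGenSet G B → IsGenSet G (A ∪ B)

/-- The collection `𝒢⁰`, as a type. -/
structure GenSet (G : Ultragraph.{u}) : Type u where
  set : Set G.V
  isGenSet : G.IsGenSet set

/-- The singleton `{v}` as an element of `𝒢⁰`. -/
def vert (G : Ultragraph.{u}) (v : G.V) : G.GenSet := ⟨{v}, .singleton v⟩

/-- The range `r(e)` as an element of `𝒢⁰`. -/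
def rng (G : Ultragraph.{u}) (e : G.E) : G.GenSet := ⟨G.r e, .range e⟩

/-- A Cuntz–Krieger `G`-family in a (not necessarily unital) `*`-ring. -/
structure CKFamily (G : Ultragraph.{u}) (A : Type*) [NonUnitalRing A] [StarRing A] where
  s : G.E → A
  p : G.GenSet → A
  partialIsometry : ∀ e, s e * star (s e) * s e = s e
  orthogonal_ranges : ∀ e f, e ≠ f → star (s e) * s f = 0
  projection : ∀ X, IsStarProjection (p X)
  p_empty : p ⟨∅, .empty⟩ = 0
  p_inter : ∀ X Y : G.GenSet, p X * p Y = p ⟨X.set ∩ Y.set, X.isGenSet.inter Y.isGenSet⟩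
  p_union : ∀ X Y : G.GenSet,
    p ⟨X.set ∪ Y.set, X.isGenSet.union Y.isGenSet⟩ = p X + p Y - p ⟨X.set ∩ Y.set, X.isGenSet.inter Y.isGenSet⟩
  initial : ∀ e, star (s e) * s e = p (G.rng e)
  /-- `s_e s_e^* ≤ p_{s(e)}`; for projections, `q ≤ p` means `p q = q`. -/
  final_le : ∀ e, p (G.vert (G.s e)) * (s e * star (s e)) = s e * star (s e)
  regular_sum : ∀ (v : G.V) (hfin : {e | G.s e = v}.Finite), {e | G.s e = v}.Nonempty →
    p (G.vert v) = ∑ e ∈ hfin.toFinset, s e * star (s e)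

/-! ### The universal C⋆-algebra -/

/-- A Cuntz–Krieger `G`-family of operators on some Hilbert space. -/
structure HilbertFamily (G : Ultragraph.{u}) : Type (u + 1) where
  H : Type u
  [normed : NormedAddCommGroup H]
  [inner : InnerProductSpace ℂ H]
  [complete : CompleteSpace H]
  fam : G.CKFamily (H →L[ℂ] H)

attribute [instance] HilbertFamily.normed HilbertFamily.inner HilbertFamily.complete

/-- The bounded elements of the product of the algebras `B(H)`, over all Cuntz–Krieger
`G`-families on Hilbert spaces `H`, with the supremum norm. -/
def Ambient (G : Ultragraph.{u}) : Type (u + 1) :=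
  lp (fun ω : G.HilbertFamily => ω.H →L[ℂ] ω.H) ∞

noncomputable instance (G : Ultragraph.{u}) : NonUnitalCStarAlgebra G.Ambient :=
  inferInstanceAs (NonUnitalCStarAlgebra (lp (fun ω : G.HilbertFamily => ω.H →L[ℂ] ω.H) ∞))

/-- The coordinate of the product at a family `ω`. -/
noncomputable def coord (G : Ultragraph.{u}) (ω : G.HilbertFamily) :
    G.Ambient →⋆ₙₐ[ℂ] (ω.H →L[ℂ] ω.H) where
  toFun a := a.1 ω
  map_smul' _ _ := rfl
  map_zero' := rfl
  map_add' _ _ := rfl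
  map_mul' _ _ := rfl
  map_star' _ := rfl

theorem norm_le_one_of_partialIsometry {A : Type*} [NonUnitalCStarAlgebra A] {x : A}
    (hx : x * star x * x = x) : ‖x‖ ≤ 1 := by
  have h1 : IsStarProjection (star x * x) := by
    refine ⟨?_, ?_⟩
    · change star x * x * (star x * x) = star x * x
      calc star x * x * (star x * x) = star x * (x * star x * x) := by simp only [mul_assoc]
        _ = _ := by rw [hx]
    · exact IsSelfAdjoint.star_mul_self x
  have h2 : ‖star x * x‖ * ‖star x * x‖ = ‖star x * x‖ := by
    rw [← CStarRing.norm_star_mul_self (x := star x * x), h1.isSelfAdjoint.star_eq,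
      h1.isIdempotentElem.eq]
  have h3 := CStarRing.norm_star_mul_self (x := x)
  have h0 := norm_nonneg x
  by_contra! h
  have : 1 < ‖star x * x‖ := by rw [h3]; nlinarith
  nlinarith

theorem CKFamily.norm_s_le {G : Ultragraph.{u}} {A : Type*} [NonUnitalCStarAlgebra A]
    (F : G.CKFamily A) (e : G.E) : ‖F.s e‖ ≤ 1 :=
  norm_le_one_of_partialIsometry (F.partialIsometry e)

theorem CKFamily.norm_p_le {G : Ultragraph.{u}} {A : Type*} [NonUnitalCStarAlgebra A]
    (F : G.CKFamily A) (X : G.GenSet) : ‖F.p X‖ ≤ 1 :=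
  norm_le_one_of_partialIsometry (by
    rw [(F.projection X).isSelfAdjoint.star_eq, (F.projection X).isIdempotentElem.eq,
      (F.projection X).isIdempotentElem.eq])

/-- The element `(S_e)_ω` of the product, where `ω = (S, P)` runs over all families. -/
noncomputable def ambS (G : Ultragraph.{u}) (e : G.E) : G.Ambient :=
  ⟨fun ω => ω.fam.s e, memℓp_infty ⟨1, by rintro _ ⟨ω, rfl⟩; exact ω.fam.norm_s_le e⟩⟩

/-- The element `(P_X)_ω` of the product, where `ω = (S, P)` runs over all families. -/
noncomputable def ambP (G : Ultragraph.{u}) (X : G.GenSet) : G.Ambient :=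
  ⟨fun ω => ω.fam.p X, memℓp_infty ⟨1, by rintro _ ⟨ω, rfl⟩; exact ω.fam.norm_p_le X⟩⟩

/-- The C⋆-subalgebra of the product generated by the elements `ambS e` and `ambP X`. -/
noncomputable def cstarSub (G : Ultragraph.{u}) : NonUnitalStarSubalgebra ℂ G.Ambient :=
  (NonUnitalStarAlgebra.adjoin ℂ (Set.range G.ambS ∪ Set.range G.ambP)).topologicalClosure

/-- `C*(G)`, the C⋆-algebra generated by a universal Cuntz–Krieger `G`-family: the completion of
the `*`-algebra generated by the symbols `s_e`, `p_X` with respect to the norm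
`‖a‖ = sup ‖π(a)‖` over all its representations `π` by Cuntz–Krieger families on Hilbert spaces,
realised in the product of all these representations. -/
def CStar (G : Ultragraph.{u}) : Type (u + 1) := G.cstarSub

noncomputable instance (G : Ultragraph.{u}) : NonUnitalCStarAlgebra G.CStar :=
  NonUnitalStarSubalgebra.nonUnitalCStarAlgebra G.cstarSub
    (h_closed := NonUnitalStarSubalgebra.isClosed_topologicalClosure _)

theorem ambS_mem (G : Ultragraph.{u}) (e : G.E) : G.ambS e ∈ G.cstarSub :=
  NonUnitalStarSubalgebra.le_topologicalClosure _
    (NonUnitalStarAlgebra.subset_adjoin ℂ _ (.inl ⟨e, rfl⟩))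

theorem ambP_mem (G : Ultragraph.{u}) (X : G.GenSet) : G.ambP X ∈ G.cstarSub :=
  NonUnitalStarSubalgebra.le_topologicalClosure _
    (NonUnitalStarAlgebra.subset_adjoin ℂ _ (.inr ⟨X, rfl⟩))

/-- The inclusion of `C*(G)` into the product. -/
noncomputable def incl (G : Ultragraph.{u}) : G.CStar →⋆ₙₐ[ℂ] G.Ambient :=
  NonUnitalStarSubalgebraClass.subtype G.cstarSub

/-- The coordinate at a family `ω`, as a `*`-homomorphism from `C*(G)` to `B(H)`. -/
noncomputable def rep (G : Ultragraph.{u}) (ω : G.HilbertFamily) :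
    G.CStar →⋆ₙₐ[ℂ] (ω.H →L[ℂ] ω.H) :=
  (G.coord ω).comp G.incl

theorem CStar.ext_rep {G : Ultragraph.{u}} {a b : G.CStar} (h : ∀ ω, G.rep ω a = G.rep ω b) :
    a = b :=
  Subtype.ext (lp.ext (funext h))

/-- The canonical generator `s_e` of `C*(G)`. -/
noncomputable def genS (G : Ultragraph.{u}) (e : G.E) : G.CStar := ⟨G.ambS e, G.ambS_mem e⟩

/-- The canonical generator `p_X` of `C*(G)`. -/
noncomputable def genP (G : Ultragraph.{u}) (X : G.GenSet) : G.CStar := ⟨G.ambP X, G.ambP_mem X⟩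

theorem rep_genS (G : Ultragraph.{u}) (ω : G.HilbertFamily) (e : G.E) :
    G.rep ω (G.genS e) = ω.fam.s e := rfl

theorem rep_genP (G : Ultragraph.{u}) (ω : G.HilbertFamily) (X : G.GenSet) :
    G.rep ω (G.genP X) = ω.fam.p X := rfl

/-- The canonical Cuntz–Krieger `G`-family in `C*(G)`. -/
noncomputable def gen (G : Ultragraph.{u}) : G.CKFamily G.CStar where
  s := G.genS
  p := G.genP
  partialIsometry e := CStar.ext_rep fun ω => by
    simpa only [map_mul, map_star, rep_genS] using ω.fam.partialIsometry e
  orthogonal_ranges e f h := CStar.ext_rep fun ω => by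
    simpa only [map_mul, map_star, rep_genS, map_zero] using ω.fam.orthogonal_ranges e f h
  projection X := ⟨CStar.ext_rep fun ω => by
      simpa only [map_mul, rep_genP] using (ω.fam.projection X).isIdempotentElem.eq,
    CStar.ext_rep fun ω => by
      simpa only [map_star, rep_genP] using (ω.fam.projection X).isSelfAdjoint.star_eq⟩
  p_empty := CStar.ext_rep fun ω => by
    simpa only [rep_genP, map_zero] using ω.fam.p_empty
  p_inter X Y := CStar.ext_rep fun ω => by
    simpa only [map_mul, rep_genP] using ω.fam.p_inter X Y
  p_union X Y := CStar.ext_rep fun ω => by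
    simpa only [map_add, map_sub, rep_genP] using ω.fam.p_union X Y
  initial e := CStar.ext_rep fun ω => by
    simpa only [map_mul, map_star, rep_genS, rep_genP] using ω.fam.initial e
  final_le e := CStar.ext_rep fun ω => by
    simpa only [map_mul, map_star, rep_genS, rep_genP] using ω.fam.final_le e
  regular_sum v hfin hne := CStar.ext_rep fun ω => by
    simpa only [map_sum, map_mul, map_star, rep_genS, rep_genP] using
      ω.fam.regular_sum v hfin hne

/-- `C*(G)` is generated by the canonical family: a closed `*`-subalgebra that contains all the
generators is everything. -/
theorem eq_top_of_gen_mem (G : Ultragraph.{u}) (S : NonUnitalStarSubalgebra ℂ G.CStar)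
    (hS : IsClosed (S : Set G.CStar)) (hs : ∀ e, G.gen.s e ∈ S) (hp : ∀ X, G.gen.p X ∈ S) :
    S = ⊤ := by
  have hemb : Topology.IsClosedEmbedding G.incl :=
    (NonUnitalStarSubalgebra.isClosed_topologicalClosure _).isClosedEmbedding_subtypeVal
  have hcl : IsClosed ((S.map G.incl : NonUnitalStarSubalgebra ℂ G.Ambient) : Set G.Ambient) :=
    hemb.isClosedMap _ hS
  have hle : G.cstarSub ≤ S.map G.incl := by
    refine NonUnitalStarSubalgebra.topologicalClosure_minimal _ ?_ hcl
    refine NonUnitalStarAlgebra.adjoin_le ?_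
    rintro _ (⟨e, rfl⟩ | ⟨X, rfl⟩)
    · exact ⟨G.gen.s e, hs e, rfl⟩
    · exact ⟨G.gen.p X, hp X, rfl⟩
  refine eq_top_iff.2 fun a _ => ?_
  obtain ⟨b, hb, hba⟩ := hle a.2
  have : b = a := hemb.injective hba
  exact this ▸ hb

/-- Every Cuntz–Krieger `G`-family on a Hilbert space is the image of the canonical one under a
unique `*`-homomorphism. -/
theorem existsUnique_rep (G : Ultragraph.{u}) (ω : G.HilbertFamily) :
    ∃! φ : G.CStar →⋆ₙₐ[ℂ] (ω.H →L[ℂ] ω.H),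
      (∀ e, φ (G.gen.s e) = ω.fam.s e) ∧ ∀ X, φ (G.gen.p X) = ω.fam.p X := by
  refine ⟨G.rep ω, ⟨fun _ => rfl, fun _ => rfl⟩, ?_⟩
  rintro ψ ⟨hs, hp⟩
  have hc : ∀ φ : G.CStar →⋆ₙₐ[ℂ] (ω.H →L[ℂ] ω.H), Continuous φ := fun φ =>
    AddMonoidHomClass.continuous_of_bound φ 1 fun a => by
      simpa only [one_mul] using NonUnitalStarAlgHom.norm_apply_le φ a
  have := G.eq_top_of_gen_mem (NonUnitalStarAlgHom.equalizer ψ (G.rep ω))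
    (isClosed_eq (hc _) (hc _)) hs hp
  ext1 a
  have ha : a ∈ NonUnitalStarAlgHom.equalizer ψ (G.rep ω) := this ▸ trivial
  exact ha

/-! ### Corners -/

section Corner

variable {A : Type*} [NonUnitalCStarAlgebra A]

/-- Strict convergence in the multiplier algebra: `x n a → p a` and `a x n → a p` in norm, for
all `a` in `A`. -/
def StrictlyTendsto (x : ℕ → 𝓜(ℂ, A)) (p : 𝓜(ℂ, A)) : Prop :=
  ∀ a : A, Tendsto (fun n => (x n).fst a) atTop (𝓝 (p.fst a)) ∧
    Tendsto (fun n => (x n).snd a) atTop (𝓝 (p.snd a))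

theorem eq_of_forall_mul_eq {x y : A} (h : ∀ z, z * x = z * y) : x = y := by
  have h1 : star (x - y) * (x - y) = 0 := by rw [mul_sub, h, sub_self]
  exact sub_eq_zero.1 ((CStarRing.star_mul_self_eq_zero_iff _).1 h1)

theorem eq_of_forall_eq_mul {x y : A} (h : ∀ z, x * z = y * z) : x = y := by
  have h1 : (x - y) * star (x - y) = 0 := by rw [sub_mul, h, sub_self]
  exact sub_eq_zero.1 ((CStarRing.mul_star_self_eq_zero_iff _).1 h1)

theorem fst_mul (p : 𝓜(ℂ, A)) (x y : A) : p.fst (x * y) = p.fst x * y :=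
  eq_of_forall_mul_eq fun z => by
    rw [← p.central, ← mul_assoc, p.central, mul_assoc]

theorem snd_mul (p : 𝓜(ℂ, A)) (x y : A) : p.snd (x * y) = x * p.snd y :=
  eq_of_forall_eq_mul fun z => by
    rw [p.central, mul_assoc, mul_assoc, p.central]

theorem fst_snd_comm (p : 𝓜(ℂ, A)) (b : A) : p.fst (p.snd b) = p.snd (p.fst b) :=
  eq_of_forall_mul_eq fun z => by
    rw [← p.central, ← snd_mul, p.central, snd_mul]

/-- The corner `pAp` of `A`, for a projection `p` in the multiplier algebra of `A`. Here
`p.fst` and `p.snd` are left and right multiplication by `p`. -/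
def corner (p : 𝓜(ℂ, A)) (hp : IsStarProjection p) : NonUnitalStarSubalgebra ℂ A where
  carrier := Set.range fun b : A => p.fst (p.snd b)
  add_mem' := by
    rintro _ _ ⟨a, rfl⟩ ⟨b, rfl⟩
    exact ⟨a + b, by simp only [map_add]⟩
  zero_mem' := ⟨0, by simp only [map_zero]⟩
  mul_mem' := by
    rintro _ _ ⟨a, rfl⟩ ⟨b, rfl⟩
    have hf : ∀ x, p.fst (p.fst x) = p.fst x := fun x =>
      DFunLike.congr_fun (congrArg (fun q : 𝓜(ℂ, A) => q.fst) hp.isIdempotentElem.eq) x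
    have hs : ∀ x, p.snd (p.snd x) = p.snd x := fun x =>
      DFunLike.congr_fun (congrArg (fun q : 𝓜(ℂ, A) => q.snd) hp.isIdempotentElem.eq) x
    refine ⟨p.fst (p.snd a) * p.fst (p.snd b), ?_⟩
    simp only
    rw [snd_mul, fst_mul, hf, ← fst_snd_comm p (p.snd b), hs]
  smul_mem' := by
    rintro c _ ⟨a, rfl⟩
    exact ⟨c • a, by simp only [map_smul]⟩
  star_mem' := by
    rintro _ ⟨a, rfl⟩
    have hstar : ∀ x, p.fst (star x) = star (p.snd x) := fun x => by
      have h := DoubleCentralizer.star_fst p (star x)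
      rwa [hp.isSelfAdjoint.star_eq, star_star] at h
    have hstar' : ∀ x, p.snd (star x) = star (p.fst x) := fun x => by
      have h := DoubleCentralizer.star_snd p (star x)
      rwa [hp.isSelfAdjoint.star_eq, star_star] at h
    refine ⟨star a, ?_⟩
    simp only
    rw [hstar', hstar, fst_snd_comm]

/-- The corner `pAp` is full: no proper closed two-sided ideal of `A` contains it. -/
def IsFullCorner (p : 𝓜(ℂ, A)) (hp : IsStarProjection p) : Prop :=
  ∀ J : TwoSidedIdeal A, IsClosed (J : Set A) → (corner p hp : Set A) ⊆ J → J = ⊤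

end Corner

/-! ### Desingularizations -/

def IsSink (G : Ultragraph.{u}) (v : G.V) : Prop := {e | G.s e = v} = ∅

def IsInfiniteEmitter (G : Ultragraph.{u}) (v : G.V) : Prop := {e | G.s e = v}.Infinite

def IsSingular (G : Ultragraph.{u}) (v : G.V) : Prop := G.IsSink v ∨ G.IsInfiniteEmitter v

/-- For each infinite emitter `v`, a listing `g_1, g_2, …` of `s⁻¹(v)` without repetition
(`g_{n+1}` has index `n`). -/
abbrev EmitterListing (G : Ultragraph.{u}) : Type u :=
  ∀ v : {v : G.V // G.IsInfiniteEmitter v}, ℕ ≃ {e : G.E // G.s e = v.1}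

/-- The vertices `v = v_0, v_1, v_2, …` of the tail added at the singular vertex `v`. -/
def tailVertex {G : Ultragraph.{u}} (v : {v : G.V // G.IsSingular v}) :
    ℕ → G.V ⊕ ({v : G.V // G.IsSingular v} × ℕ)
  | 0 => .inl v.1
  | n + 1 => .inr (v, n)

/-- The desingularization of `G` obtained by adding a tail at every singular vertex, with the
given listings of the edges that leave the infinite emitters. Its edges are
* the edges of `G` whose source is not an infinite emitter;
* for every singular vertex `v` the tail edges `e_{n+1}` (index `n`), from `v_n` to `v_{n+1}`;
* for every infinite emitter `v` the edges `f_{n+1}` (index `n`), with source `v_n` and with the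
  range of `g_{n+1}`, which replace the edges `g_{n+1}`. -/
def desingularization (G : Ultragraph.{u}) (g : G.EmitterListing) : Ultragraph.{u} where
  V := G.V ⊕ ({v : G.V // G.IsSingular v} × ℕ)
  E := {e : G.E // ¬ G.IsInfiniteEmitter (G.s e)} ⊕
    (({v : G.V // G.IsSingular v} × ℕ) ⊕ ({v : G.V // G.IsInfiniteEmitter v} × ℕ))
  countable_V := by
    have := G.countable_V
    infer_instance
  countable_E := by
    have := G.countable_V
    have := G.countable_E
    infer_instance
  s
    | .inl e => .inl (G.s e.1)
    | .inr (.inl (v, n)) => tailVertex v n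
    | .inr (.inr (v, n)) => tailVertex ⟨v.1, .inr v.2⟩ n
  r
    | .inl e => Sum.inl '' G.r e.1
    | .inr (.inl (v, n)) => {tailVertex v (n + 1)}
    | .inr (.inr (v, n)) => Sum.inl '' G.r (g v n).1
  r_nonempty
    | .inl e => (G.r_nonempty e.1).image _
    | .inr (.inl (_, _)) => Set.singleton_nonempty _
    | .inr (.inr (v, n)) => (G.r_nonempty (g v n).1).image _

/-- The inclusion of the vertices of `G` into those of the desingularization. -/
def inclV (G : Ultragraph.{u}) (g : G.EmitterListing) : G.V → (G.desingularization g).V := Sum.inl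

theorem isGenSet_image (G : Ultragraph.{u}) (g : G.EmitterListing) {X : Set G.V}
    (hX : G.IsGenSet X) : (G.desingularization g).IsGenSet (G.inclV g '' X) := by
  induction hX with
  | empty => rw [Set.image_empty]; exact .empty
  | singleton v => rw [Set.image_singleton]; exact .singleton _
  | range e =>
    by_cases h : G.IsInfiniteEmitter (G.s e)
    · have := IsGenSet.range (G := G.desingularization g)
        (.inr (.inr (⟨G.s e, h⟩, (g ⟨G.s e, h⟩).symm ⟨e, rfl⟩)))
      have h2 : (G.desingularization g).r
          (.inr (.inr (⟨G.s e, h⟩, (g ⟨G.s e, h⟩).symm ⟨e, rfl⟩))) = G.inclV g '' G.r e := by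
        change Sum.inl '' G.r (g ⟨G.s e, h⟩ ((g ⟨G.s e, h⟩).symm ⟨e, rfl⟩)).1 = _
        rw [Equiv.apply_symm_apply]
        rfl
      exact h2 ▸ this
    · exact IsGenSet.range (G := G.desingularization g) (.inl ⟨e, h⟩)
  | inter _ _ ihA ihB =>
    have hinj : Function.Injective (G.inclV g) := Sum.inl_injective
    rw [Set.image_inter hinj]
    exact ihA.inter ihB
  | union _ _ ihA ihB => rw [Set.image_union]; exact ihA.union ihB

/-- A set in `𝒢⁰`, regarded as a set of vertices of the desingularization. -/
def GenSet.toDesing {G : Ultragraph.{u}} (g : G.EmitterListing) (X : G.GenSet) :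
    (G.desingularization g).GenSet :=
  ⟨G.inclV g '' X.set, G.isGenSet_image g X.isGenSet⟩

/-- The underlying set of `A_n = {w_1, …, w_n} ∪ r(h_1) ∪ … ∪ r(h_n)`. -/
def initialSet (G : Ultragraph.{u}) (w : ℕ → Option G.V) (h : ℕ → Option G.E) (n : ℕ) :
    Set G.V :=
  {v | ∃ i < n, w i = some v} ∪ {v | ∃ i < n, ∃ e, h i = some e ∧ v ∈ G.r e}

theorem isGenSet_initialSet (G : Ultragraph.{u}) (w : ℕ → Option G.V) (h : ℕ → Option G.E)
    (n : ℕ) : G.IsGenSet (G.initialSet w h n) := by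
  induction n with
  | zero =>
    have : G.initialSet w h 0 = ∅ := by simp [initialSet]
    rw [this]
    exact .empty
  | succ n ih =>
    have h1 : G.IsGenSet {v | w n = some v} := by
      cases hw : w n with
      | none => simpa using IsGenSet.empty
      | some v => simpa [Set.ofPred_eq_eq_singleton'] using IsGenSet.singleton v
    have h2 : G.IsGenSet {v | ∃ e, h n = some e ∧ v ∈ G.r e} := by
      cases hh : h n with
      | none => simpa using IsGenSet.empty
      | some e => simpa using IsGenSet.range e
    have : G.initialSet w h (n + 1) =
        G.initialSet w h n ∪ ({v | w n = some v} ∪ {v | ∃ e, h n = some e ∧ v ∈ G.r e}) := by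
      ext v
      simp only [initialSet, Set.mem_union, Set.mem_ofPred_eq, Nat.exists_lt_succ_right]
      grind
    rw [this]
    exact ih.union (h1.union h2)

/-- The set `A_n = {w_1, …, w_n} ∪ r(h_1) ∪ … ∪ r(h_n)` for a list `w_1, w_2, …` of vertices and
a list `h_1, h_2, …` of edges. The `i`-th entries have index `i - 1`; the value `none` stands for
a missing entry, so that finite lists are allowed. -/
def initialGenSet (G : Ultragraph.{u}) (w : ℕ → Option G.V) (h : ℕ → Option G.E) (n : ℕ) :
    G.GenSet :=
  ⟨G.initialSet w h n, G.isGenSet_initialSet w h n⟩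

end Ultragraph

namespace Ultragraph

/-! Write F for the desingularization, and number tail vertices `v_0 = v, v_1, ...` and listed edges
`g_0, g_1, ...` from zero, as the code does. The isomorphism sends `p_X` to `q_X`, a kept edge to
itself, and the listed edge `g_n` at `v` to the path that follows the tail to `v_n` and leaves it
there. These elements form a Cuntz–Krieger G-family (`CKFamily.restrict`): paths with different
exits are orthogonal, and the only summation relations required concern regular vertices, whose
edges are all kept. This gives `toDesingHom : C*(G) → C*(F)`.

Injectivity needs no uniqueness theorem. A G-family on H dilates to an F-family on a Hilbert sum of
copies of H, one copy for all old vertices together and one for each added vertex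
(`CKFamily.dilate`). On its copy, `v_n` acts as the remainder `R_n = p_v - ∑_{j<n} s_{g_j}
s_{g_j}^*`, and a tail edge carries `R_{n+1}` from one copy to the preceding one. The relation at
`v_n` then reads `R_n = R_{n+1} + s_{g_n} s_{g_n}^*` (without the last term at a sink). Restricting
the dilation to G returns the original family on the first copy, so every representation of `C*(G)`
factors through `toDesingHom`, and representations separate points.

Strict convergence holds because `q_{A_n}` is increasing and `q_{A_n} a` is eventually constant for
the generating vertex projections `a`: it is eventually `a` at an old vertex and always zero at an
added one. The elements where both `q_{A_n} a` and `q_{A_n} a^*` converge form a closed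
`*`-subalgebra, hence everything. Fullness holds because tail edges transport membership in an ideal
from `q_v` to every `q_{v_n}`, and vertex projections generate everything as an ideal.

For surjectivity onto the corner, let S be the range of `toDesingHom`, closed because injective
`*`-homomorphisms are isometric. The connectors `c_i` are the projections `q_X` with `X` in `𝒢⁰` and
the tail paths. Every generator `b` satisfies `c_i b c_j^* ∈ S`; since vertex and range projections
of F have the form `c^* c`, products can be split at a connector and the property spreads to all of
`C*(F)` (`connector_compression_mem`). With `c_i = c_j = q_{A_n}` this gives `q_{A_n} x q_{A_n} ∈
S`, which converges to `x` when `x` is in the corner. -/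

theorem GenSet.ext {G : Ultragraph.{u}} {X Y : G.GenSet} (h : X.set = Y.set) : X = Y := by
  cases X; cases Y; cases h; rfl

theorem GenSet.induction {G : Ultragraph.{u}} {P : G.GenSet → Prop} (empty : P ⟨∅, .empty⟩)
    (vert : ∀ v, P (G.vert v)) (rng : ∀ e, P (G.rng e))
    (inter : ∀ X Y : G.GenSet, P X → P Y → P ⟨X.set ∩ Y.set, X.isGenSet.inter Y.isGenSet⟩)
    (union : ∀ X Y : G.GenSet, P X → P Y → P ⟨X.set ∪ Y.set, X.isGenSet.union Y.isGenSet⟩)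
    (X : G.GenSet) : P X := by
  obtain ⟨X, hX⟩ := X
  induction hX with
  | empty => exact empty
  | singleton v => exact vert v
  | range e => exact rng e
  | inter hA hB ihA ihB => exact inter ⟨_, hA⟩ ⟨_, hB⟩ ihA ihB
  | union hA hB ihA ihB => exact union ⟨_, hA⟩ ⟨_, hB⟩ ihA ihB

/-! ### Elementary relations in a Cuntz–Krieger family -/

namespace CKFamily

variable {G : Ultragraph.{u}} {A : Type*} [NonUnitalRing A] [StarRing A] (F : G.CKFamily A)

theorem star_p (X : G.GenSet) : star (F.p X) = F.p X := (F.projection X).isSelfAdjoint.star_eq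

theorem p_mul_self (X : G.GenSet) : F.p X * F.p X = F.p X := (F.projection X).isIdempotentElem.eq

theorem p_mul_of_subset {X Y : G.GenSet} (h : X.set ⊆ Y.set) : F.p X * F.p Y = F.p X := by
  rw [F.p_inter]
  exact congrArg F.p (GenSet.ext (Set.inter_eq_left.2 h))

theorem p_mul_of_superset {X Y : G.GenSet} (h : Y.set ⊆ X.set) : F.p X * F.p Y = F.p Y := by
  rw [F.p_inter]
  exact congrArg F.p (GenSet.ext (Set.inter_eq_right.2 h))

theorem p_mul_of_disjoint {X Y : G.GenSet} (h : Disjoint X.set Y.set) : F.p X * F.p Y = 0 := by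
  rw [F.p_inter, ← F.p_empty]
  exact congrArg F.p (GenSet.ext h.inter_eq)

theorem p_vert_mul_p_vert {v w : G.V} (h : v ≠ w) : F.p (G.vert v) * F.p (G.vert w) = 0 :=
  F.p_mul_of_disjoint (Set.disjoint_singleton.2 h)

theorem p_vert_mul_s (e : G.E) : F.p (G.vert (G.s e)) * F.s e = F.s e := by
  conv_lhs => rw [← F.partialIsometry e, ← mul_assoc, F.final_le, F.partialIsometry]

theorem s_mul_p_rng (e : G.E) : F.s e * F.p (G.rng e) = F.s e := by
  rw [← F.initial, ← mul_assoc, F.partialIsometry]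

theorem star_s_mul_p_vert (e : G.E) : star (F.s e) * F.p (G.vert (G.s e)) = star (F.s e) := by
  rw [← F.star_p, ← star_mul, F.p_vert_mul_s]

theorem p_rng_mul_star_s (e : G.E) : F.p (G.rng e) * star (F.s e) = star (F.s e) := by
  rw [← F.star_p, ← star_mul, F.s_mul_p_rng]

theorem p_vert_mul_s_of_ne {v : G.V} {e : G.E} (h : v ≠ G.s e) : F.p (G.vert v) * F.s e = 0 := by
  rw [← F.p_vert_mul_s, ← mul_assoc, F.p_vert_mul_p_vert h, zero_mul]

theorem p_mul_s_of_mem {X : G.GenSet} {e : G.E} (h : G.s e ∈ X.set) : F.p X * F.s e = F.s e := by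
  rw [← F.p_vert_mul_s, ← mul_assoc, F.p_mul_of_superset (Set.singleton_subset_iff.2 h)]

theorem p_mul_s_of_notMem {X : G.GenSet} {e : G.E} (h : G.s e ∉ X.set) : F.p X * F.s e = 0 := by
  rw [← F.p_vert_mul_s, ← mul_assoc, F.p_mul_of_disjoint (Set.disjoint_singleton_right.2 h),
    zero_mul]

end CKFamily

/-! ### Edges of the desingularization -/

section Edges

variable {G : Ultragraph.{u}} (g : G.EmitterListing)

/-- An edge of `G` that is kept in the desingularization. -/
def keptEdge (e : {e : G.E // ¬ G.IsInfiniteEmitter (G.s e)}) : (G.desingularization g).E := .inl e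

/-- The tail edge from `v_n` to `v_{n+1}`. -/
def tailEdge (v : {v : G.V // G.IsSingular v}) (n : ℕ) : (G.desingularization g).E :=
  .inr (.inl (v, n))

/-- The edge that leaves the tail at `v_n` and replaces the `n`-th edge emitted by `v`. -/
def emitEdge (v : {v : G.V // G.IsInfiniteEmitter v}) (n : ℕ) : (G.desingularization g).E :=
  .inr (.inr (v, n))

/-- The vertex `v_n`, as a vertex of the desingularization. -/
def tailVert (v : {v : G.V // G.IsSingular v}) (n : ℕ) : (G.desingularization g).V :=
  tailVertex v n

/-- An infinite emitter, as a singular vertex. -/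
def emitterSingular (v : {v : G.V // G.IsInfiniteEmitter v}) : {v : G.V // G.IsSingular v} :=
  ⟨v.1, .inr v.2⟩

theorem source_keptEdge (e : {e : G.E // ¬ G.IsInfiniteEmitter (G.s e)}) :
    (G.desingularization g).s (keptEdge g e) = G.inclV g (G.s e.1) := rfl

theorem source_tailEdge (v : {v : G.V // G.IsSingular v}) (n : ℕ) :
    (G.desingularization g).s (tailEdge g v n) = tailVert g v n := rfl

theorem source_emitEdge (v : {v : G.V // G.IsInfiniteEmitter v}) (n : ℕ) :
    (G.desingularization g).s (emitEdge g v n) = tailVert g (emitterSingular v) n := rfl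

theorem rng_keptEdge (e : {e : G.E // ¬ G.IsInfiniteEmitter (G.s e)}) :
    (G.desingularization g).rng (keptEdge g e) = (G.rng e.1).toDesing g := rfl

theorem rng_tailEdge (v : {v : G.V // G.IsSingular v}) (n : ℕ) :
    (G.desingularization g).rng (tailEdge g v n) =
      (G.desingularization g).vert (tailVert g v (n + 1)) := rfl

theorem rng_emitEdge (v : {v : G.V // G.IsInfiniteEmitter v}) (n : ℕ) :
    (G.desingularization g).rng (emitEdge g v n) = (G.rng (g v n).1).toDesing g := rfl

theorem toDesing_vert (v : G.V) :
    (G.vert v).toDesing g = (G.desingularization g).vert (G.inclV g v) :=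
  GenSet.ext Set.image_singleton

theorem tailVert_zero (v : {v : G.V // G.IsSingular v}) : tailVert g v 0 = G.inclV g v.1 := rfl

theorem tailVert_succ_ne_inclV (v : {v : G.V // G.IsSingular v}) (n : ℕ) (w : G.V) :
    tailVert g v (n + 1) ≠ G.inclV g w := Sum.inr_ne_inl

theorem tailVert_inj {v v' : {v : G.V // G.IsSingular v}} {n n' : ℕ} :
    tailVert g v n = tailVert g v' n' ↔ v = v' ∧ n = n' := by
  refine ⟨fun h => ?_, fun ⟨h, h'⟩ => h ▸ h' ▸ rfl⟩
  match n, n', h with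
  | 0, 0, h => exact ⟨Subtype.ext (Sum.inl_injective h), rfl⟩
  | 0, n + 1, h => exact absurd h Sum.inl_ne_inr
  | n + 1, 0, h => exact absurd h Sum.inr_ne_inl
  | n + 1, n' + 1, h =>
    obtain ⟨rfl, rfl⟩ := Prod.ext_iff.1 (Sum.inr_injective h)
    exact ⟨rfl, rfl⟩

theorem edge_cases {P : (G.desingularization g).E → Prop} (kept : ∀ e, P (keptEdge g e))
    (tail : ∀ v n, P (tailEdge g v n)) (emit : ∀ v n, P (emitEdge g v n)) :
    ∀ e, P e
  | .inl e => kept e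
  | .inr (.inl (v, n)) => tail v n
  | .inr (.inr (v, n)) => emit v n

/-- Added vertices are the `v_{n+1}`; `v_0` is the old vertex `v`, so the two cases do not overlap.
-/
theorem vert_cases {P : (G.desingularization g).V → Prop} (incl : ∀ v, P (G.inclV g v))
    (tail : ∀ v n, P (tailVert g v (n + 1))) : ∀ x, P x
  | .inl v => incl v
  | .inr (v, n) => tail v n

theorem keptEdge_injective : Function.Injective (keptEdge g) := Sum.inl_injective

theorem tailEdge_ne_emitEdge (v v' n n') : tailEdge g v n ≠ emitEdge g v' n' := by
  rintro ⟨⟩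

theorem IsSingular.not_finite_nonempty {v : G.V} (hv : G.IsSingular v)
    (hfin : {e | G.s e = v}.Finite) (hne : {e | G.s e = v}.Nonempty) : False :=
  hv.elim (fun h => hne.ne_empty h) fun h => h hfin

/-- The source emits `e` itself, so it is not a sink, and it is not an infinite emitter because `e`
is kept. -/
theorem keptEdge_source_not_singular (e : {e : G.E // ¬ G.IsInfiniteEmitter (G.s e)}) :
    ¬ G.IsSingular (G.s e.1) := fun h =>
  h.elim (fun h => (h ▸ (rfl : G.s e.1 = G.s e.1) : e.1 ∈ (∅ : Set G.E))) e.2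

theorem source_keptEdge_ne (e : {e : G.E // ¬ G.IsInfiniteEmitter (G.s e)})
    (v : {v : G.V // G.IsSingular v}) (n : ℕ) : G.inclV g (G.s e.1) ≠ tailVert g v n := by
  intro h
  -- For positive `n` the two vertices lie in different summands of the vertex type, so only `v_0`
  -- remains.
  match n, h with
  | 0, h => exact keptEdge_source_not_singular e ((Sum.inl_injective h : G.s e.1 = v.1) ▸ v.2)

theorem edgesFrom_tailVert_of_sink (v : {v : G.V // G.IsSingular v})
    (hv : ¬ G.IsInfiniteEmitter v.1) (n : ℕ) :
    {e | (G.desingularization g).s e = tailVert g v n} = {tailEdge g v n} := by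
  ext e
  simp only [Set.mem_ofPred_eq, Set.mem_singleton_iff]
  refine ⟨fun h => ?_, fun h => h ▸ rfl⟩
  induction e using edge_cases with
  | kept e => exact absurd h (source_keptEdge_ne g e v n)
  | tail w m => obtain ⟨rfl, rfl⟩ := (tailVert_inj g).1 h; rfl
  | emit w m =>
    obtain ⟨rfl, rfl⟩ := (tailVert_inj g).1 h
    exact absurd w.2 hv

theorem edgesFrom_tailVert_of_emitter (v : {v : G.V // G.IsInfiniteEmitter v}) (n : ℕ) :
    {e | (G.desingularization g).s e = tailVert g (emitterSingular v) n} =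
      {tailEdge g (emitterSingular v) n, emitEdge g v n} := by
  ext e
  simp only [Set.mem_ofPred_eq, Set.mem_insert_iff, Set.mem_singleton_iff]
  refine ⟨fun h => ?_, fun h => h.elim (· ▸ rfl) (· ▸ rfl)⟩
  induction e using edge_cases with
  | kept e => exact absurd h (source_keptEdge_ne g e _ n)
  | tail w m => obtain ⟨rfl, rfl⟩ := (tailVert_inj g).1 h; exact .inl rfl
  | emit w m =>
    obtain ⟨hw, rfl⟩ := (tailVert_inj g).1 h
    have : w = v := Subtype.ext (congrArg (fun x => x.1) hw :)
    subst this
    exact .inr rfl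

theorem edgesFrom_inclV_of_not_singular {v : G.V} (hv : ¬ G.IsSingular v) :
    {e | (G.desingularization g).s e = G.inclV g v} =
      keptEdge g '' {e | G.s e.1 = v} := by
  ext e
  simp only [Set.mem_ofPred_eq, Set.mem_image]
  refine ⟨fun h => ?_, ?_⟩
  · have aux : ∀ (w : {v : G.V // G.IsSingular v}) (m : ℕ), tailVert g w m ≠ G.inclV g v := by
      rintro w (_ | m) h
      · exact hv ((Sum.inl_injective h : w.1 = v) ▸ w.2)
      · exact tailVert_succ_ne_inclV g w m v h
    induction e using edge_cases with
    | kept e => exact ⟨e, Sum.inl_injective h, rfl⟩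
    | tail w m => exact absurd h (aux _ _)
    | emit w m => exact absurd h (aux _ _)
  · rintro ⟨e, rfl, rfl⟩
    rfl

/-- Every edge of `G` is kept or is one of the edges listed at an infinite emitter. -/
theorem edge_kept_or_listed {P : G.E → Prop}
    (kept : ∀ e : {e : G.E // ¬ G.IsInfiniteEmitter (G.s e)}, P e.1)
    (listed : ∀ v n, P (g v n).1) (e : G.E) : P e := by
  by_cases h : G.IsInfiniteEmitter (G.s e)
  · have := listed ⟨G.s e, h⟩ ((g ⟨G.s e, h⟩).symm ⟨e, rfl⟩)
    rwa [Equiv.apply_symm_apply] at this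
  · exact kept ⟨e, h⟩

theorem listed_ne_kept (v n) (e : {e : G.E // ¬ G.IsInfiniteEmitter (G.s e)}) :
    (g v n).1 ≠ e.1 := fun h => e.2 (h ▸ (g v n).2.symm ▸ v.2)

theorem listed_inj {v v' : {v : G.V // G.IsInfiniteEmitter v}} {n n' : ℕ}
    (h : (g v n).1 = (g v' n').1) : v = v' ∧ n = n' := by
  have hv : v = v' := Subtype.ext ((g v n).2.symm.trans ((congrArg G.s h).trans (g v' n').2))
  subst hv
  exact ⟨rfl, (g v).injective (Subtype.ext h)⟩

end Edges

/-! ### Restriction of families of the desingularization -/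

namespace CKFamily

variable {G : Ultragraph.{u}} {g : G.EmitterListing}
  {A : Type*} [NonUnitalRing A] [StarRing A] (F : (G.desingularization g).CKFamily A)

/-- The partial isometry of the path from `v` to `v_n` along the tail. -/
def tailPath (v : {v : G.V // G.IsSingular v}) : ℕ → A
  | 0 => F.p ((G.desingularization g).vert (tailVert g v 0))
  | n + 1 => tailPath v n * F.s (tailEdge g v n)

theorem tailPath_succ (v : {v : G.V // G.IsSingular v}) (n : ℕ) :
    F.tailPath v (n + 1) = F.tailPath v n * F.s (tailEdge g v n) := rfl

theorem p_mul_tailPath (v : {v : G.V // G.IsSingular v}) (n : ℕ) :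
    F.p ((G.desingularization g).vert (tailVert g v 0)) * F.tailPath v n = F.tailPath v n := by
  induction n with
  | zero => exact F.p_mul_self _
  | succ n ih => rw [tailPath_succ, ← mul_assoc, ih]

theorem tailPath_mul_p (v : {v : G.V // G.IsSingular v}) (n : ℕ) :
    F.tailPath v n * F.p ((G.desingularization g).vert (tailVert g v n)) = F.tailPath v n := by
  cases n with
  | zero => exact F.p_mul_self _
  | succ n => rw [tailPath_succ, mul_assoc, ← rng_tailEdge, F.s_mul_p_rng]

theorem star_tailPath_mul_self (v : {v : G.V // G.IsSingular v}) (n : ℕ) :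
    star (F.tailPath v n) * F.tailPath v n =
      F.p ((G.desingularization g).vert (tailVert g v n)) := by
  induction n with
  | zero => rw [tailPath, F.star_p, F.p_mul_self]
  | succ n ih =>
    rw [tailPath_succ, star_mul, mul_assoc, ← mul_assoc (star (F.tailPath v n)), ih,
      ← source_tailEdge, F.p_vert_mul_s, F.initial, rng_tailEdge]

/-- The partial isometry of the path from `v` that leaves the tail at `v_n`. -/
def exitPath (v : {v : G.V // G.IsInfiniteEmitter v}) (n : ℕ) : A :=
  F.tailPath (emitterSingular v) n * F.s (emitEdge g v n)

theorem p_mul_exitPath (v : {v : G.V // G.IsInfiniteEmitter v}) (n : ℕ) :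
    F.p ((G.desingularization g).vert (G.inclV g v.1)) * F.exitPath v n = F.exitPath v n := by
  rw [exitPath, ← mul_assoc]
  exact congrArg (· * _) (F.p_mul_tailPath (emitterSingular v) n)

theorem star_exitPath_mul_self (v : {v : G.V // G.IsInfiniteEmitter v}) (n : ℕ) :
    star (F.exitPath v n) * F.exitPath v n = F.p ((G.rng (g v n).1).toDesing g) := by
  rw [exitPath, star_mul, mul_assoc, ← mul_assoc (star (F.tailPath _ n)), star_tailPath_mul_self,
    ← source_emitEdge, F.p_vert_mul_s, F.initial, rng_emitEdge]

/-- The two paths agree up to `v_n` and then use different edges there, whose ranges are orthogonal.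
The other orthogonality relations between exit paths follow from this one. -/
theorem star_exitPath_mul_tailPath (v : {v : G.V // G.IsInfiniteEmitter v}) (n k : ℕ) :
    star (F.exitPath v n) * F.tailPath (emitterSingular v) (n + 1 + k) = 0 := by
  induction k with
  | zero =>
    rw [exitPath, star_mul, mul_assoc, add_zero, tailPath_succ,
      ← mul_assoc (star (F.tailPath _ n)), star_tailPath_mul_self, ← source_tailEdge,
      F.p_vert_mul_s, F.orthogonal_ranges _ _ (tailEdge_ne_emitEdge g _ _ _ _).symm]
  | succ k ih => rw [← add_assoc, tailPath_succ, ← mul_assoc, ih, zero_mul]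

theorem star_exitPath_mul_exitPath_of_lt (v : {v : G.V // G.IsInfiniteEmitter v}) {n m : ℕ}
    (h : n < m) : star (F.exitPath v n) * F.exitPath v m = 0 := by
  obtain ⟨k, rfl⟩ := Nat.exists_eq_add_of_lt h
  rw [exitPath.eq_1 F v (n + k + 1), ← mul_assoc, add_right_comm, star_exitPath_mul_tailPath,
    zero_mul]

theorem star_exitPath_mul_exitPath_of_ne (v : {v : G.V // G.IsInfiniteEmitter v}) {n m : ℕ}
    (h : n ≠ m) : star (F.exitPath v n) * F.exitPath v m = 0 := by
  rcases h.lt_or_gt with h | h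
  · exact F.star_exitPath_mul_exitPath_of_lt v h
  · have := congrArg star (F.star_exitPath_mul_exitPath_of_lt v h)
    rwa [star_mul, star_star, star_zero] at this

/-- In F the vertex `v_n` is regular; this is its summation relation conjugated by the path from `v`
to `v_n`. -/
theorem tailPath_mul_star_eq_of_sink (v : {v : G.V // G.IsSingular v})
    (hv : ¬ G.IsInfiniteEmitter v.1) (n : ℕ) :
    F.tailPath v n * star (F.tailPath v n) = F.tailPath v (n + 1) * star (F.tailPath v (n + 1)) := by
  have hset := edgesFrom_tailVert_of_sink g v hv n
  have hfin : {e | (G.desingularization g).s e = tailVert g v n}.Finite :=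
    hset ▸ Set.finite_singleton _
  have hsum := F.regular_sum _ hfin (hset ▸ Set.singleton_nonempty _)
  have : hfin.toFinset = {tailEdge g v n} := by ext; simp [hset]
  rw [this, Finset.sum_singleton] at hsum
  have h1 : F.tailPath v n * star (F.tailPath v n) =
      F.tailPath v n * F.p ((G.desingularization g).vert (tailVert g v n)) *
        star (F.tailPath v n) := by rw [F.tailPath_mul_p]
  rw [h1, hsum]
  simp only [tailPath_succ, star_mul, mul_assoc]

theorem tailPath_mul_star_eq_of_emitter (v : {v : G.V // G.IsInfiniteEmitter v}) (n : ℕ) :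
    F.tailPath (emitterSingular v) n * star (F.tailPath (emitterSingular v) n) =
      F.tailPath (emitterSingular v) (n + 1) * star (F.tailPath (emitterSingular v) (n + 1)) +
        F.exitPath v n * star (F.exitPath v n) := by
  classical
  have hset := edgesFrom_tailVert_of_emitter g v n
  have hfin : {e | (G.desingularization g).s e = tailVert g (emitterSingular v) n}.Finite :=
    hset ▸ Set.toFinite _
  have hsum := F.regular_sum _ hfin (hset ▸ Set.insert_nonempty _ _)
  have : hfin.toFinset = {tailEdge g (emitterSingular v) n, emitEdge g v n} := by ext; simp [hset]
  rw [this, Finset.sum_pair (tailEdge_ne_emitEdge g _ _ _ _)] at hsum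
  have h1 : F.tailPath (emitterSingular v) n * star (F.tailPath (emitterSingular v) n) =
      F.tailPath (emitterSingular v) n *
        F.p ((G.desingularization g).vert (tailVert g (emitterSingular v) n)) *
          star (F.tailPath (emitterSingular v) n) := by rw [F.tailPath_mul_p]
  rw [h1, hsum]
  simp only [tailPath_succ, exitPath, star_mul, mul_assoc, mul_add, add_mul]

open Classical in
/-- The partial isometry that a family of the desingularization attaches to an edge of `G`. -/
noncomputable def restrictS (e : G.E) : A :=
  if h : G.IsInfiniteEmitter (G.s e) then
    F.exitPath ⟨G.s e, h⟩ ((g ⟨G.s e, h⟩).symm ⟨e, rfl⟩)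
  else F.s (keptEdge g ⟨e, h⟩)

theorem restrictS_kept (e : {e : G.E // ¬ G.IsInfiniteEmitter (G.s e)}) :
    F.restrictS e.1 = F.s (keptEdge g e) := dif_neg e.2

theorem restrictS_listed (v n) : F.restrictS (g v n).1 = F.exitPath v n := by
  have h : G.IsInfiniteEmitter (G.s (g v n).1) := (g v n).2.symm ▸ v.2
  rw [restrictS, dif_pos h]
  -- `restrictS` looks the edge up in the listing at its own source; `listed_inj` identifies that
  -- vertex and that index with `v` and `n`.
  obtain ⟨hv, hn⟩ := listed_inj g (v := ⟨_, h⟩)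
    (n := (g ⟨_, h⟩).symm ⟨(g v n).1, rfl⟩) (v' := v) (n' := n) (by rw [Equiv.apply_symm_apply])
  rw [hn, hv]

theorem p_mul_restrictS (e : G.E) :
    F.p ((G.desingularization g).vert (G.inclV g (G.s e))) * F.restrictS e = F.restrictS e := by
  induction e using edge_kept_or_listed g with
  | kept e =>
    rw [restrictS_kept]
    exact F.p_vert_mul_s (keptEdge g e)
  | listed v n => rw [restrictS_listed, (g v n).2, p_mul_exitPath]

theorem star_restrictS_mul_self (e : G.E) :
    star (F.restrictS e) * F.restrictS e = F.p ((G.rng e).toDesing g) := by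
  induction e using edge_kept_or_listed g with
  | kept e =>
    rw [restrictS_kept]
    exact F.initial (keptEdge g e)
  | listed v n => rw [restrictS_listed, star_exitPath_mul_self]

/-- With a common source, the edges become either two exit paths of one tail or two kept edges; with
distinct sources, the vertex projections are already orthogonal. -/
theorem star_restrictS_mul_of_ne {e f : G.E} (hne : e ≠ f) :
    star (F.restrictS e) * F.restrictS f = 0 := by
  by_cases hs : G.s e = G.s f
  · by_cases he : G.IsInfiniteEmitter (G.s e)
    · have h1 := F.restrictS_listed ⟨_, he⟩ ((g ⟨_, he⟩).symm ⟨e, rfl⟩)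
      have h2 := F.restrictS_listed ⟨_, he⟩ ((g ⟨_, he⟩).symm ⟨f, hs.symm⟩)
      rw [Equiv.apply_symm_apply] at h1 h2
      simp only at h1 h2
      rw [h1, h2]
      refine F.star_exitPath_mul_exitPath_of_ne _ fun h => hne ?_
      exact congrArg Subtype.val ((g ⟨_, he⟩).symm.injective h)
    · have h1 := F.restrictS_kept ⟨e, he⟩
      have h2 := F.restrictS_kept ⟨f, hs ▸ he⟩
      simp only at h1 h2
      rw [h1, h2]
      exact F.orthogonal_ranges _ _ fun h => hne (congrArg Subtype.val (keptEdge_injective g h))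
  · rw [← F.p_mul_restrictS e, ← F.p_mul_restrictS f, star_mul, F.star_p, mul_assoc,
      ← mul_assoc (F.p _), F.p_vert_mul_p_vert (v := G.inclV g (G.s e)) (w := G.inclV g (G.s f)) fun h => hs (Sum.inl_injective h), zero_mul, mul_zero]

/-- A family of the desingularization restricts to a family of `G`. -/
noncomputable def restrict : G.CKFamily A where
  s := F.restrictS
  p X := F.p (X.toDesing g)
  partialIsometry := by
    refine edge_kept_or_listed g (fun e => ?_) (fun v n => ?_)
    · rw [restrictS_kept]
      exact F.partialIsometry _
    · rw [mul_assoc, star_restrictS_mul_self, restrictS_listed, exitPath, mul_assoc, ← rng_emitEdge,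
        F.s_mul_p_rng]
  orthogonal_ranges _ _ := F.star_restrictS_mul_of_ne
  projection _ := F.projection _
  p_empty := by
    rw [← F.p_empty]
    exact congrArg F.p (GenSet.ext (Set.image_empty _))
  p_inter X Y := by
    rw [F.p_inter]
    exact congrArg F.p (GenSet.ext (Set.image_inter Sum.inl_injective).symm)
  p_union X Y := by
    have h1 : GenSet.toDesing g ⟨X.set ∪ Y.set, X.isGenSet.union Y.isGenSet⟩ =
        ⟨_, (X.toDesing g).isGenSet.union (Y.toDesing g).isGenSet⟩ :=
      GenSet.ext (Set.image_union _ _ _)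
    have h2 : GenSet.toDesing g ⟨X.set ∩ Y.set, X.isGenSet.inter Y.isGenSet⟩ =
        ⟨_, (X.toDesing g).isGenSet.inter (Y.toDesing g).isGenSet⟩ :=
      GenSet.ext (Set.image_inter Sum.inl_injective)
    rw [h1, h2, F.p_union]
  initial := F.star_restrictS_mul_self
  final_le e := by rw [← mul_assoc, toDesing_vert, F.p_mul_restrictS]
  regular_sum v hfin hne := by
    -- A summation relation is required only at regular vertices; there every edge is kept and no
    -- tail is attached, so the relation in F is the same one.
    have hv : ¬ G.IsSingular v := fun h => h.not_finite_nonempty hfin hne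
    have hset := edgesFrom_inclV_of_not_singular g hv
    have hk : ∀ e, G.s e = v → ¬ G.IsInfiniteEmitter (G.s e) := fun e he h => hv (.inr (he ▸ h))
    have hfin' : {e | (G.desingularization g).s e = G.inclV g v}.Finite := by
      rw [hset]
      exact (hfin.preimage Subtype.val_injective.injOn).image _
    have hne' : {e | (G.desingularization g).s e = G.inclV g v}.Nonempty := by
      obtain ⟨e, he⟩ := hne
      rw [hset]
      exact ⟨_, ⟨e, hk e he⟩, he, rfl⟩
    rw [toDesing_vert, F.regular_sum _ hfin' hne']
    symm
    refine Finset.sum_bij (fun e he => keptEdge g ⟨e, hk e (hfin.mem_toFinset.1 he)⟩) ?_ ?_ ?_ ?_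
    · intro e he
      rw [hfin'.mem_toFinset, hset]
      exact ⟨_, hfin.mem_toFinset.1 he, rfl⟩
    · intro e _ f _ h
      exact congrArg Subtype.val (keptEdge_injective g h)
    · intro f hf
      rw [hfin'.mem_toFinset, hset] at hf
      obtain ⟨e, he, rfl⟩ := hf
      exact ⟨e.1, hfin.mem_toFinset.2 he, rfl⟩
    · intro e he
      rw [← restrictS_kept]

end CKFamily

/-! ### Strict limits of projections -/

section StrictLimit

variable {A : Type*} [NonUnitalCStarAlgebra A]

theorem norm_mul_le_of_isStarProjection {q : A} (hq : IsStarProjection q) (a : A) :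
    ‖q * a‖ ≤ ‖a‖ := by
  have h : ‖q‖ ≤ 1 := norm_le_one_of_partialIsometry (by
    rw [hq.isSelfAdjoint.star_eq, hq.isIdempotentElem.eq, hq.isIdempotentElem.eq])
  exact (norm_mul_le _ _).trans (mul_le_of_le_one_left (norm_nonneg a) h)

/-- The elements `a` for which `q n * a` and `q n * star a` both converge. -/
def convergenceSubalgebra (q : ℕ → A) : NonUnitalStarSubalgebra ℂ A where
  carrier := {a | (∃ l, Tendsto (fun n => q n * a) atTop (𝓝 l)) ∧
    ∃ l, Tendsto (fun n => q n * star a) atTop (𝓝 l)}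
  add_mem' := by
    rintro a b ⟨⟨la, ha⟩, la', ha'⟩ ⟨⟨lb, hb⟩, lb', hb'⟩
    refine ⟨⟨la + lb, ?_⟩, la' + lb', ?_⟩
    · simpa only [mul_add] using ha.add hb
    · simpa only [star_add, mul_add] using ha'.add hb'
  zero_mem' := by
    refine ⟨⟨0, ?_⟩, 0, ?_⟩
    · simp
    · simp
  mul_mem' := by
    rintro a b ⟨⟨la, ha⟩, la', ha'⟩ ⟨⟨lb, hb⟩, lb', hb'⟩
    -- Convergence of `q n * a` passes to right multiples of `a`, and the adjoint of `a * b` is a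
    -- right multiple of `star b`.
    refine ⟨⟨la * b, ?_⟩, lb' * star a, ?_⟩
    · simpa only [mul_assoc] using ha.mul_const b
    · simpa only [star_mul, mul_assoc] using hb'.mul_const (star a)
  smul_mem' := by
    rintro c a ⟨⟨la, ha⟩, la', ha'⟩
    refine ⟨⟨c • la, ?_⟩, star c • la', ?_⟩
    · simpa only [mul_smul_comm] using ha.const_smul c
    · simpa only [star_smul, mul_smul_comm] using ha'.const_smul (star c)
  star_mem' := by
    rintro a ⟨ha, ha'⟩
    exact ⟨ha', by simpa only [star_star] using ha⟩

/-- Left multiplications by projections are contractions, so the Cauchy property survives norm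
limits by the usual `ε / 3` argument. -/
theorem isClosed_setOf_exists_tendsto_mul {q : ℕ → A} (hq : ∀ n, IsStarProjection (q n)) :
    IsClosed {a | ∃ l, Tendsto (fun n => q n * a) atTop (𝓝 l)} := by
  refine isClosed_of_closure_subset fun a ha => ?_
  refine cauchySeq_tendsto_of_complete (Metric.cauchySeq_iff'.2 fun ε hε => ?_)
  obtain ⟨b, ⟨l, hl⟩, hab⟩ := Metric.mem_closure_iff.1 ha (ε / 3) (by positivity)
  obtain ⟨N, hN⟩ := Metric.cauchySeq_iff'.1 hl.cauchySeq (ε / 3) (by positivity)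
  refine ⟨N, fun n hn => ?_⟩
  have h1 : ∀ m, dist (q m * a) (q m * b) ≤ dist a b := fun m => by
    rw [dist_eq_norm, dist_eq_norm, ← mul_sub]
    exact norm_mul_le_of_isStarProjection (hq m) _
  calc dist (q n * a) (q N * a)
      ≤ dist (q n * a) (q n * b) + dist (q n * b) (q N * b) + dist (q N * b) (q N * a) :=
        dist_triangle4 _ _ _ _
    _ < ε / 3 + ε / 3 + ε / 3 := by
        have := h1 n
        have := h1 N
        rw [dist_comm (q N * b)]
        linarith [hN n hn]
    _ = ε := by ring

theorem isClosed_convergenceSubalgebra {q : ℕ → A} (hq : ∀ n, IsStarProjection (q n)) :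
    IsClosed (convergenceSubalgebra q : Set A) :=
  (isClosed_setOf_exists_tendsto_mul hq).inter
    ((isClosed_setOf_exists_tendsto_mul hq).preimage continuous_star)

/-- An increasing sequence of projections that converges pointwise as left multiplications
converges strictly to a projection of the multiplier algebra. -/
theorem exists_strictlyTendsto {q : ℕ → A} (hq : ∀ n, IsStarProjection (q n))
    (hmono : ∀ n m, n ≤ m → q n * q m = q n)
    (hlim : ∀ a, ∃ l, Tendsto (fun n => q n * a) atTop (𝓝 l)) :
    ∃ p : 𝓜(ℂ, A), IsStarProjection p ∧ StrictlyTendsto (fun n => (q n : 𝓜(ℂ, A))) p := by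
  choose L hL using hlim
  have hLadd : ∀ a b, L (a + b) = L a + L b := fun a b =>
    tendsto_nhds_unique (hL _) (by simpa only [mul_add] using (hL a).add (hL b))
  have hLsmul : ∀ (c : ℂ) a, L (c • a) = c • L a := fun c a =>
    tendsto_nhds_unique (hL _) (by simpa only [mul_smul_comm] using (hL a).const_smul c)
  have hLnorm : ∀ a, ‖L a‖ ≤ 1 * ‖a‖ := fun a => by
    rw [one_mul]
    exact le_of_tendsto (hL a).norm (.of_forall fun n => norm_mul_le_of_isStarProjection (hq n) a)
  let l : A →L[ℂ] A := LinearMap.mkContinuous ⟨⟨L, hLadd⟩, hLsmul⟩ 1 hLnorm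
  let r : A →L[ℂ] A :=
    (((starₗᵢ ℂ : A ≃ₗᵢ⋆[ℂ] A) : A →L⋆[ℂ] A).comp l).comp ((starₗᵢ ℂ : A ≃ₗᵢ⋆[ℂ] A) : A →L⋆[ℂ] A)
  have hl : ∀ a, Tendsto (fun n => q n * a) atTop (𝓝 (l a)) := hL
  have hr' : ∀ a, r a = star (l (star a)) := fun a => rfl
  have hr : ∀ a, Tendsto (fun n => a * q n) atTop (𝓝 (r a)) := fun a => by
    have := (hl (star a)).star
    simpa only [star_mul, star_star, (hq _).isSelfAdjoint.star_eq, hr'] using this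
  -- Let `m → ∞` in `q n * q m * a = q n * a`. Letting `n → ∞` afterwards shows that `l` is
  -- idempotent.
  have hql : ∀ n a, q n * l a = q n * a := fun n a => by
    refine tendsto_nhds_unique ((hl a).const_mul (q n)) (tendsto_const_nhds.congr' ?_)
    filter_upwards [eventually_ge_atTop n] with m hm
    rw [← mul_assoc, hmono n m hm]
  have hll : ∀ a, l (l a) = l a := fun a =>
    tendsto_nhds_unique (hl (l a)) (by simpa only [hql] using hl a)
  let p : 𝓜(ℂ, A) := ⟨(l, r), fun x y => by
    refine tendsto_nhds_unique ((hr x).mul_const y) ?_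
    simpa only [mul_assoc] using (hl y).const_mul x⟩
  refine ⟨p, ⟨?_, ?_⟩, fun a => ⟨hl a, hr a⟩⟩
  · refine DoubleCentralizer.ext _ _ _ _ (Prod.ext ?_ ?_)
    · exact ContinuousLinearMap.ext hll
    · refine ContinuousLinearMap.ext fun a => ?_
      change r (r a) = r a
      simp only [hr', star_star, hll]
  · refine DoubleCentralizer.ext _ _ _ _ (Prod.ext ?_ ?_)
    · refine ContinuousLinearMap.ext fun a => ?_
      change star (r (star a)) = l a
      simp only [hr', star_star]
    · exact ContinuousLinearMap.ext fun a => rfl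

/-- As `p` is idempotent, the corner is the common fixed set of two continuous maps; this is how its
closedness and membership in it are checked. -/
theorem mem_corner_iff {p : 𝓜(ℂ, A)} (hp : IsStarProjection p) {a : A} :
    a ∈ corner p hp ↔ p.fst a = a ∧ p.snd a = a := by
  have hf : ∀ x, p.fst (p.fst x) = p.fst x := fun x =>
    DFunLike.congr_fun (congrArg (fun q : 𝓜(ℂ, A) => q.fst) hp.isIdempotentElem.eq) x
  have hs : ∀ x, p.snd (p.snd x) = p.snd x := fun x =>
    DFunLike.congr_fun (congrArg (fun q : 𝓜(ℂ, A) => q.snd) hp.isIdempotentElem.eq) x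
  constructor
  · rintro ⟨b, rfl⟩
    simp only
    exact ⟨hf _, by rw [fst_snd_comm, hs, ← fst_snd_comm]⟩
  · rintro ⟨h1, h2⟩
    exact ⟨a, by simp only [h2, h1]⟩

theorem isClosed_corner {p : 𝓜(ℂ, A)} (hp : IsStarProjection p) :
    IsClosed (corner p hp : Set A) := by
  have : (corner p hp : Set A) = {a | p.fst a = a} ∩ {a | p.snd a = a} :=
    Set.ext fun a => mem_corner_iff hp
  rw [this]
  exact (isClosed_eq p.fst.continuous continuous_id).inter
    (isClosed_eq p.snd.continuous continuous_id)

theorem StrictlyTendsto.fst_eq {q : ℕ → A} {p : 𝓜(ℂ, A)}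
    (h : StrictlyTendsto (fun n => (q n : 𝓜(ℂ, A))) p) {a : A}
    (ha : ∀ᶠ n in atTop, q n * a = a) : p.fst a = a :=
  tendsto_nhds_unique (h a).1 (tendsto_const_nhds.congr' (ha.mono fun _ h => h.symm))

theorem StrictlyTendsto.snd_eq {q : ℕ → A} {p : 𝓜(ℂ, A)}
    (h : StrictlyTendsto (fun n => (q n : 𝓜(ℂ, A))) p) {a : A}
    (ha : ∀ᶠ n in atTop, a * q n = a) : p.snd a = a :=
  tendsto_nhds_unique (h a).2 (tendsto_const_nhds.congr' (ha.mono fun _ h => h.symm))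

/-- The compressions of `a` by projections that converge strictly converge to that of `a` by
the limit. -/
theorem StrictlyTendsto.tendsto_compression {q : ℕ → A} (hq : ∀ n, IsStarProjection (q n))
    {p : 𝓜(ℂ, A)} (h : StrictlyTendsto (fun n => (q n : 𝓜(ℂ, A))) p) (a : A) :
    Tendsto (fun n => q n * (a * q n)) atTop (𝓝 (p.fst (p.snd a))) := by
  have h1 : Tendsto (fun n => q n * p.snd a) atTop (𝓝 (p.fst (p.snd a))) := (h _).1
  have h2 : Tendsto (fun n => a * q n) atTop (𝓝 (p.snd a)) := (h a).2
  -- Both factors of the compression vary with `n`; contractivity of `q n` absorbs the variation of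
  -- the right one.
  have h3 : Tendsto (fun n => q n * (a * q n - p.snd a)) atTop (𝓝 0) := by
    refine squeeze_zero_norm (fun n => norm_mul_le_of_isStarProjection (hq n) _) ?_
    simpa using (h2.sub_const (p.snd a)).norm
  simpa only [mul_sub, sub_add_cancel, zero_add] using h3.add h1

/-- The largest `*`-subalgebra contained in a two-sided ideal. -/
def idealSubalgebra (J : TwoSidedIdeal A) : NonUnitalStarSubalgebra ℂ A where
  -- A ring ideal is not assumed stable under scalars or adjoints, so both are built into the
  -- condition.
  carrier := {a | ∀ c : ℂ, c • a ∈ J ∧ c • star a ∈ J}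
  add_mem' := fun ha hb c => by
    simp only [star_add, smul_add]
    exact ⟨J.add_mem (ha c).1 (hb c).1, J.add_mem (ha c).2 (hb c).2⟩
  zero_mem' := fun c => by simp [J.zero_mem]
  mul_mem' := fun {a b} ha hb c => by
    rw [← smul_mul_assoc, star_mul, ← mul_smul_comm]
    exact ⟨J.mul_mem_right _ _ (ha c).1, J.mul_mem_left _ _ (ha c).2⟩
  smul_mem' := fun d a ha c => by
    rw [star_smul, smul_smul, smul_smul]
    exact ⟨(ha _).1, (ha _).2⟩
  star_mem' := fun {a} ha c => ⟨(ha c).2, by rw [star_star]; exact (ha c).1⟩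

theorem idealSubalgebra_subset (J : TwoSidedIdeal A) {a : A} (h : a ∈ idealSubalgebra J) :
    a ∈ J := by simpa only [one_smul] using (h 1).1

theorem isClosed_idealSubalgebra {J : TwoSidedIdeal A} (hJ : IsClosed (J : Set A)) :
    IsClosed (idealSubalgebra J : Set A) := by
  have : (idealSubalgebra J : Set A) =
      ⋂ c : ℂ, (fun a => c • a) ⁻¹' (J : Set A) ∩ (fun a => c • star a) ⁻¹' (J : Set A) := by
    ext a
    simp only [Set.mem_iInter]
    rfl
  rw [this]
  exact isClosed_iInter fun c => (hJ.preimage (continuous_const_smul c)).inter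
    (hJ.preimage (continuous_star.const_smul c))

/-- The factor `x` absorbs the scalar in `c • a = x * (c • a)`, and `y` does the same for `star a =
y * star a`. No approximate unit is needed. -/
theorem mem_idealSubalgebra_of_factor {J : TwoSidedIdeal A} {a x y : A}
    (h1 : a = x * a) (hx : x ∈ J) (h2 : a = a * y) (hy : y ∈ J) (hy' : star y = y) : a ∈ idealSubalgebra J := fun c => by
  constructor
  · rw [h1, ← mul_smul_comm]
    exact J.mul_mem_right _ _ hx
  · rw [h2, star_mul, hy', ← mul_smul_comm]
    exact J.mul_mem_right _ _ hy

end StrictLimit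

/-! ### The projection of a desingularization -/

section Projection

variable {G : Ultragraph.{u}}

theorem initialSet_mono (w : ℕ → Option G.V) (h : ℕ → Option G.E) {n m : ℕ} (hnm : n ≤ m) :
    G.initialSet w h n ⊆ G.initialSet w h m := by
  rintro v (⟨i, hi, hv⟩ | ⟨i, hi, hv⟩)
  · exact .inl ⟨i, hi.trans_le hnm, hv⟩
  · exact .inr ⟨i, hi.trans_le hnm, hv⟩

theorem eventually_subset_initialSet {w : ℕ → Option G.V} (hw : ∀ v, ∃ i, w i = some v)
    {h : ℕ → Option G.E} (hh : ∀ e, ∃ i, h i = some e) (X : G.GenSet) :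
    ∀ᶠ n in atTop, X.set ⊆ G.initialSet w h n := by
  induction X using GenSet.induction with
  | empty => exact .of_forall fun n => Set.empty_subset _
  | vert v =>
    obtain ⟨i, hi⟩ := hw v
    filter_upwards [eventually_gt_atTop i] with n hn
    rintro _ rfl
    exact .inl ⟨i, hn, hi⟩
  | rng e =>
    obtain ⟨i, hi⟩ := hh e
    filter_upwards [eventually_gt_atTop i] with n hn v hv
    exact .inr ⟨i, hn, e, hi, hv⟩
  | inter X Y hX hY => exact hX.mono fun n hn => Set.inter_subset_left.trans hn
  | union X Y hX hY => exact (hX.and hY).mono fun n hn => Set.union_subset hn.1 hn.2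

variable {g : G.EmitterListing} {A : Type*}

theorem toDesing_disjoint_tailVert (X : G.GenSet) (v : {v : G.V // G.IsSingular v}) (n : ℕ) :
    Disjoint (X.toDesing g).set ((G.desingularization g).vert (tailVert g v (n + 1))).set := by
  refine Set.disjoint_singleton_right.2 ?_
  rintro ⟨x, _, hx⟩
  exact tailVert_succ_ne_inclV g v n x hx.symm

theorem toDesing_mono {X Y : G.GenSet} (h : X.set ⊆ Y.set) :
    (X.toDesing g).set ⊆ (Y.toDesing g).set := Set.image_mono h

section Family

variable {w : ℕ → Option G.V} {h : ℕ → Option G.E}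

theorem CKFamily.eventually_initial_mul_p [NonUnitalRing A] [StarRing A]
    (F : (G.desingularization g).CKFamily A)
    (hw : ∀ v, ∃ i, w i = some v) (hh : ∀ e, ∃ i, h i = some e) (X : G.GenSet) :
    ∀ᶠ n in atTop, F.p ((G.initialGenSet w h n).toDesing g) * F.p (X.toDesing g) =
      F.p (X.toDesing g) := by
  filter_upwards [eventually_subset_initialSet hw hh X] with n hn
  exact F.p_mul_of_superset (toDesing_mono hn)

theorem CKFamily.eventually_p_mul_initial [NonUnitalRing A] [StarRing A]
    (F : (G.desingularization g).CKFamily A)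
    (hw : ∀ v, ∃ i, w i = some v) (hh : ∀ e, ∃ i, h i = some e) (X : G.GenSet) :
    ∀ᶠ n in atTop, F.p (X.toDesing g) * F.p ((G.initialGenSet w h n).toDesing g) =
      F.p (X.toDesing g) := by
  filter_upwards [eventually_subset_initialSet hw hh X] with n hn
  exact F.p_mul_of_subset (toDesing_mono hn)

variable [NonUnitalCStarAlgebra A] (F : (G.desingularization g).CKFamily A)

/-- The projections `q_{A_n}`. -/
noncomputable def CKFamily.initialProj (w : ℕ → Option G.V) (h : ℕ → Option G.E) (n : ℕ) : A :=
  F.p ((G.initialGenSet w h n).toDesing g)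

theorem CKFamily.tendsto_initialProj_mul_vert
    (hw : ∀ v, ∃ i, w i = some v) (hh : ∀ e, ∃ i, h i = some e) (x : (G.desingularization g).V) :
    ∃ l, Tendsto (fun n => F.initialProj w h n * F.p ((G.desingularization g).vert x)) atTop
      (𝓝 l) := by
  induction x using vert_cases with
  | incl v =>
    rw [← toDesing_vert]
    exact ⟨_, tendsto_const_nhds.congr'
      ((F.eventually_initial_mul_p hw hh (G.vert v)).mono fun _ hn => hn.symm)⟩
  | tail v k =>
    refine ⟨0, tendsto_const_nhds.congr fun n => ?_⟩
    exact (F.p_mul_of_disjoint (toDesing_disjoint_tailVert _ v k)).symm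

theorem CKFamily.tendsto_initialProj_mul_rng
    (hw : ∀ v, ∃ i, w i = some v) (hh : ∀ e, ∃ i, h i = some e) (e : (G.desingularization g).E) :
    ∃ l, Tendsto (fun n => F.initialProj w h n * F.p ((G.desingularization g).rng e)) atTop
      (𝓝 l) := by
  have key : ∀ X : G.GenSet, ∃ l,
      Tendsto (fun n => F.initialProj w h n * F.p (X.toDesing g)) atTop (𝓝 l) := fun X =>
    ⟨_, tendsto_const_nhds.congr'
      ((F.eventually_initial_mul_p hw hh X).mono fun _ hn => hn.symm)⟩
  induction e using edge_cases with
  | kept e => exact key (G.rng e.1)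
  | tail v n => exact F.tendsto_initialProj_mul_vert hw hh _
  | emit v n => exact key (G.rng (g v n).1)

/-- Since `s_e = p_{s(e)} s_e` and `s_e^* = p_{r(e)} s_e^*`, convergence reduces to that at the
source and range projections. -/
theorem CKFamily.s_mem_convergenceSubalgebra
    (hw : ∀ v, ∃ i, w i = some v) (hh : ∀ e, ∃ i, h i = some e) (e : (G.desingularization g).E) :
    F.s e ∈ convergenceSubalgebra (F.initialProj w h) := by
  obtain ⟨l, hl⟩ := F.tendsto_initialProj_mul_vert hw hh ((G.desingularization g).s e)
  obtain ⟨l', hl'⟩ := F.tendsto_initialProj_mul_rng hw hh e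
  refine ⟨⟨l * F.s e, ?_⟩, l' * star (F.s e), ?_⟩
  · simpa only [mul_assoc, F.p_vert_mul_s] using hl.mul_const (F.s e)
  · simpa only [mul_assoc, F.p_rng_mul_star_s] using hl'.mul_const (star (F.s e))

/-- Range projections are `s_e^* s_e`, intersections are products, and unions follow by
inclusion–exclusion. Later density arguments therefore need only vertices and edges. -/
theorem CKFamily.p_mem_of_vert_of_s {G : Ultragraph.{u}} (F : G.CKFamily A)
    (S : NonUnitalStarSubalgebra ℂ A) (hv : ∀ v, F.p (G.vert v) ∈ S) (hs : ∀ e, F.s e ∈ S)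
    (X : G.GenSet) : F.p X ∈ S := by
  have hinter : ∀ X Y : G.GenSet, F.p X ∈ S → F.p Y ∈ S →
      F.p ⟨X.set ∩ Y.set, X.isGenSet.inter Y.isGenSet⟩ ∈ S := fun X Y hX hY => by
    rw [← F.p_inter]
    exact S.mul_mem hX hY
  induction X using GenSet.induction with
  | empty => rw [F.p_empty]; exact S.zero_mem
  | vert v => exact hv v
  | rng e => rw [← F.initial]; exact mul_mem (star_mem (hs e)) (hs e)
  | inter X Y hX hY => exact hinter X Y hX hY
  | union X Y hX hY => rw [F.p_union]; exact sub_mem (S.add_mem hX hY) (hinter X Y hX hY)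

end Family

theorem eq_top_of_vert_mem_of_s_mem (G : Ultragraph.{u}) (S : NonUnitalStarSubalgebra ℂ G.CStar)
    (hS : IsClosed (S : Set G.CStar)) (hv : ∀ v, G.gen.p (G.vert v) ∈ S)
    (hs : ∀ e, G.gen.s e ∈ S) : S = ⊤ :=
  G.eq_top_of_gen_mem S hS hs (G.gen.p_mem_of_vert_of_s S hv hs)

variable {w : ℕ → Option G.V} {h : ℕ → Option G.E}

theorem isStarProjection_initialProj (w : ℕ → Option G.V) (h : ℕ → Option G.E) (n : ℕ) :
    IsStarProjection ((G.desingularization g).gen.initialProj w h n) :=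
  (G.desingularization g).gen.projection _

/-- The projections `q_{A_n}` converge strictly. -/
theorem exists_strictlyTendsto_initialProj (g : G.EmitterListing)
    (hw : ∀ v, ∃ i, w i = some v) (hh : ∀ e, ∃ i, h i = some e) :
    ∃ p : 𝓜(ℂ, (G.desingularization g).CStar), IsStarProjection p ∧
      StrictlyTendsto (fun n => ((G.desingularization g).gen.initialProj w h n :
        𝓜(ℂ, (G.desingularization g).CStar))) p := by
  have htop := eq_top_of_vert_mem_of_s_mem _
    (convergenceSubalgebra ((G.desingularization g).gen.initialProj w h))
    (isClosed_convergenceSubalgebra (isStarProjection_initialProj w h))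
    (fun x => by
      have := (G.desingularization g).gen.tendsto_initialProj_mul_vert hw hh x
      exact ⟨this, by rwa [CKFamily.star_p]⟩)
    ((G.desingularization g).gen.s_mem_convergenceSubalgebra hw hh)
  refine exists_strictlyTendsto (isStarProjection_initialProj w h) (fun n m hnm => ?_) fun a => ?_
  · exact CKFamily.p_mul_of_subset _ (toDesing_mono (initialSet_mono w h hnm))
  · have ha : a ∈ convergenceSubalgebra ((G.desingularization g).gen.initialProj w h) :=
      htop ▸ trivial
    exact ha.1

variable {p : 𝓜(ℂ, (G.desingularization g).CStar)}

theorem p_toDesing_mem_corner (hp : IsStarProjection p)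
    (hlim : StrictlyTendsto (fun n => ((G.desingularization g).gen.initialProj w h n :
      𝓜(ℂ, (G.desingularization g).CStar))) p)
    (hw : ∀ v, ∃ i, w i = some v) (hh : ∀ e, ∃ i, h i = some e) (X : G.GenSet) :
    (G.desingularization g).gen.p (X.toDesing g) ∈ corner p hp :=
  (mem_corner_iff hp).2 ⟨hlim.fst_eq (CKFamily.eventually_initial_mul_p _ hw hh X),
    hlim.snd_eq (CKFamily.eventually_p_mul_initial _ hw hh X)⟩

/-- The corner cut out by the limit of the `q_{A_n}` is full. -/
theorem isFullCorner_of_strictlyTendsto (hp : IsStarProjection p)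
    (hlim : StrictlyTendsto (fun n => ((G.desingularization g).gen.initialProj w h n :
      𝓜(ℂ, (G.desingularization g).CStar))) p)
    (hw : ∀ v, ∃ i, w i = some v) (hh : ∀ e, ∃ i, h i = some e) : IsFullCorner p hp := by
  intro J hJ hsub
  set F := (G.desingularization g).gen with hF
  have hG : ∀ X : G.GenSet, F.p (X.toDesing g) ∈ J := fun X =>
    hsub (p_toDesing_mem_corner hp hlim hw hh X)
  have htail : ∀ (v : {v : G.V // G.IsSingular v}) (n : ℕ),
      F.p ((G.desingularization g).vert (tailVert g v n)) ∈ J := by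
    intro v n
    induction n with
    | zero =>
      rw [tailVert_zero, ← toDesing_vert]
      exact hG _
    | succ n ih =>
      -- For the tail edge `e` from `v_n` to `v_{n+1}`, `q_{v_{n+1}} = t_e^* t_e` and `t_e = q_{v_n}
      -- t_e`, so the ideal passes along the tail.
      rw [← rng_tailEdge, ← F.initial, ← F.p_vert_mul_s, source_tailEdge]
      exact J.mul_mem_left _ _ (J.mul_mem_right _ _ ih)
  have hv : ∀ x, F.p ((G.desingularization g).vert x) ∈ J := fun x => by
    induction x using vert_cases with
    | incl v =>
      rw [← toDesing_vert]
      exact hG _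
    | tail v n => exact htail v (n + 1)
  have htop : idealSubalgebra J = ⊤ := by
    refine eq_top_of_vert_mem_of_s_mem _ _ (isClosed_idealSubalgebra hJ) (fun x => ?_) fun e => ?_
    · exact mem_idealSubalgebra_of_factor (F.p_mul_self _).symm (hv x) (F.p_mul_self _).symm (hv x)
        (F.star_p _)
    · refine mem_idealSubalgebra_of_factor (F.p_vert_mul_s e).symm (hv _) (F.s_mul_p_rng e).symm ?_
        (F.star_p _)
      rw [← F.initial, ← F.p_vert_mul_s]
      exact J.mul_mem_left _ _ (J.mul_mem_right _ _ (hv _))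
  refine eq_top_iff.2 fun a _ => idealSubalgebra_subset J ?_
  rw [htop]
  trivial

end Projection

/-! ### Systems of matrix units -/

/-- A system of maps `x ↦ x ⊗ e_{ij}` from a `*`-algebra `A` to a `*`-algebra `B`. -/
structure MatrixSystem (ι : Type*) (A B : Type*) [NonUnitalRing A] [StarRing A]
    [Module ℂ A] [NonUnitalRing B] [StarRing B] [Module ℂ B] where
  toFun : ι → ι → A →ₗ[ℂ] B
  mul_same : ∀ i j k x y, toFun i j x * toFun j k y = toFun i k (x * y)
  mul_ne : ∀ i j j' k x y, j ≠ j' → toFun i j x * toFun j' k y = 0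
  star_eq : ∀ i j x, star (toFun i j x) = toFun j i (star x)

/-- The diagonal entry of a matrix system, as a `*`-homomorphism. -/
def MatrixSystem.diag {ι : Type*} {A B : Type*} [NonUnitalRing A] [StarRing A]
    [Module ℂ A] [NonUnitalRing B] [StarRing B] [Module ℂ B] (M : MatrixSystem ι A B) (i : ι) :
    A →⋆ₙₐ[ℂ] B where
  toFun := M.toFun i i
  map_smul' c x := map_smul _ c x
  map_zero' := map_zero _
  map_add' x y := map_add _ x y
  map_mul' x y := (M.mul_same i i i x y).symm
  map_star' x := (M.star_eq i i x).symm

section HilbertMatrix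

variable (ι : Type u) (H : Type u) [NormedAddCommGroup H] [InnerProductSpace ℂ H]
  [CompleteSpace H]

/-- The Hilbert space sum of copies of `H` indexed by `ι`. -/
abbrev HilbertSum : Type u := lp (fun _ : ι => H) 2

variable {ι H} in
open Classical in
/-- The inclusion of the `i`-th summand. -/
noncomputable def summand (i : ι) : H →L[ℂ] HilbertSum ι H :=
  lp.singleContinuousLinearMap ℂ (fun _ : ι => H) 2 i

variable {ι H} in
theorem adjoint_summand_apply (i : ι) (f : HilbertSum ι H) :
    ContinuousLinearMap.adjoint (summand i) f = f i :=
  ext_inner_left ℂ fun x => by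
    classical
    rw [ContinuousLinearMap.adjoint_inner_right]
    exact lp.inner_single_left (𝕜 := ℂ) (G := fun _ : ι => H) i x f

variable {ι H} in
theorem adjoint_summand_summand (i : ι) (x : H) :
    ContinuousLinearMap.adjoint (summand (ι := ι) i) (summand i x) = x := by
  rw [adjoint_summand_apply]
  classical exact lp.single_apply_self (E := fun _ : ι => H) 2 i x

variable {ι H} in
theorem adjoint_summand_summand_of_ne {i j : ι} (h : i ≠ j) (x : H) :
    ContinuousLinearMap.adjoint (summand (ι := ι) i) (summand j x) = 0 := by
  rw [adjoint_summand_apply]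
  classical exact lp.single_apply_ne (E := fun _ : ι => H) 2 j x h

/-- The operators on the sum of copies of `H` with a single nonzero matrix entry. -/
noncomputable def hilbertMatrixSystem :
    MatrixSystem ι (H →L[ℂ] H) (HilbertSum ι H →L[ℂ] HilbertSum ι H) where
  toFun i j :=
    { toFun := fun x => (summand i).comp (x.comp (ContinuousLinearMap.adjoint (summand j)))
      map_add' := fun x y => by ext1 f; simp
      map_smul' := fun c x => by ext1 f; simp }
  mul_same i j k x y := by
    ext1 f
    simp [adjoint_summand_summand]
  mul_ne i j j' k x y h := by
    ext1 f
    simp [adjoint_summand_summand_of_ne h]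
  star_eq i j x := by
    simp only [LinearMap.coe_mk, AddHom.coe_mk, ContinuousLinearMap.star_eq_adjoint,
      ContinuousLinearMap.adjoint_comp, ContinuousLinearMap.adjoint_adjoint,
      ContinuousLinearMap.comp_assoc]

theorem hilbertMatrixSystem_diag_injective (i : ι) :
    Function.Injective ((hilbertMatrixSystem ι H).diag i) := by
  intro x y h
  ext1 v
  have h1 := congrArg (ContinuousLinearMap.adjoint (summand i)) (DFunLike.congr_fun h (summand i v))
  have h2 : ∀ z : H →L[ℂ] H, ContinuousLinearMap.adjoint (summand i)
      ((hilbertMatrixSystem ι H).diag i z (summand i v)) = z v := fun z => by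
    change ContinuousLinearMap.adjoint (summand (ι := ι) i)
      (summand i (z (ContinuousLinearMap.adjoint (summand i) (summand i v)))) = z v
    rw [adjoint_summand_summand, adjoint_summand_summand]
  rwa [h2, h2] at h1

end HilbertMatrix

/-! ### Dilation of families to the desingularization -/

section GenSets

variable {G : Ultragraph.{u}} {g : G.EmitterListing}

/-- Needed so that a G-family has a projection for the old vertices in a set from `𝓕⁰`. -/
theorem isGenSet_preimage_inl {X : Set (G.desingularization g).V}
    (hX : (G.desingularization g).IsGenSet X) : G.IsGenSet (G.inclV g ⁻¹' X) := by
  have himg : ∀ Y : Set G.V, G.IsGenSet Y → G.IsGenSet (G.inclV g ⁻¹' (G.inclV g '' Y)) :=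
    fun Y hY => (Set.preimage_image_eq Y Sum.inl_injective).symm ▸ hY
  have htail : ∀ v n, G.IsGenSet (G.inclV g ⁻¹' {tailVert g v (n + 1)}) := fun v n => by
    have : G.inclV g ⁻¹' {tailVert g v (n + 1)} = ∅ :=
      Set.eq_empty_of_forall_notMem fun w hw => tailVert_succ_ne_inclV g v n w hw.symm
    rw [this]
    exact .empty
  induction hX with
  | empty => exact .empty
  | singleton x =>
    induction x using vert_cases with
    | incl v =>
      have := himg {v} (.singleton v)
      rwa [Set.image_singleton] at this
    | tail v n => exact htail v n
  | range e =>
    induction e using edge_cases with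
    | kept e => exact himg _ (.range e.1)
    | tail v n => exact htail v n
    | emit v n => exact himg _ (.range (g v n).1)
  | inter _ _ h1 h2 => exact h1.inter h2
  | union _ _ h1 h2 => exact h1.union h2

/-- The inclusion of the added vertices. -/
def addedV (g : G.EmitterListing) (y : {v : G.V // G.IsSingular v} × ℕ) :
    (G.desingularization g).V := tailVert g y.1 (y.2 + 1)

theorem addedV_injective : Function.Injective (addedV g) := Sum.inr_injective

theorem preimage_addedV_image (Y : Set G.V) : addedV g ⁻¹' (G.inclV g '' Y) = ∅ :=
  Set.eq_empty_of_forall_notMem fun y ⟨_, _, h⟩ => tailVert_succ_ne_inclV g y.1 y.2 _ h.symm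

/-- Singletons and ranges of edges contain at most one added vertex. Hence the projections of the
dilated family are finite sums. -/
theorem finite_preimage_addedV {X : Set (G.desingularization g).V}
    (hX : (G.desingularization g).IsGenSet X) : (addedV g ⁻¹' X).Finite := by
  have himg : ∀ Y : Set G.V, (addedV g ⁻¹' (G.inclV g '' Y)).Finite := fun Y =>
    preimage_addedV_image (g := g) Y ▸ Set.finite_empty
  have hsing : ∀ x, (addedV g ⁻¹' {x}).Finite := fun x =>
    (Set.finite_singleton x).preimage addedV_injective.injOn
  induction hX with
  | empty => exact Set.finite_empty
  | singleton x => exact hsing x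
  | range e =>
    induction e using edge_cases with
    | kept e => exact himg _
    | tail v n => exact hsing _
    | emit v n => exact himg _
  | inter _ _ h1 h2 => exact h1.inter_of_left _
  | union _ _ h1 h2 => exact h1.union h2

/-- The vertices of `G` in a set of vertices of the desingularization. -/
def GenSet.base (X : (G.desingularization g).GenSet) : G.GenSet :=
  ⟨G.inclV g ⁻¹' X.set, isGenSet_preimage_inl X.isGenSet⟩

/-- The added vertices in a set of vertices of the desingularization. -/
noncomputable def GenSet.added (X : (G.desingularization g).GenSet) :
    Finset ({v : G.V // G.IsSingular v} × ℕ) :=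
  (finite_preimage_addedV X.isGenSet).toFinset

theorem GenSet.mem_added {X : (G.desingularization g).GenSet} {y} :
    y ∈ X.added ↔ addedV g y ∈ X.set :=
  (finite_preimage_addedV X.isGenSet).mem_toFinset

theorem GenSet.base_toDesing (X : G.GenSet) : (X.toDesing g).base = X :=
  GenSet.ext (Set.preimage_image_eq _ Sum.inl_injective)

theorem GenSet.added_toDesing (X : G.GenSet) : (X.toDesing g).added = ∅ := by
  ext y
  rw [mem_added]
  refine iff_of_false (fun h => ?_) (Finset.notMem_empty y)
  have : y ∈ addedV g ⁻¹' (G.inclV g '' X.set) := h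
  rwa [preimage_addedV_image] at this

theorem base_vert_addedV (y) : ((G.desingularization g).vert (addedV g y)).base =
    ⟨∅, .empty⟩ :=
  GenSet.ext (Set.eq_empty_of_forall_notMem fun w hw =>
    tailVert_succ_ne_inclV g y.1 y.2 w hw.symm)

theorem added_vert_addedV (y) : ((G.desingularization g).vert (addedV g y)).added = {y} := by
  ext z
  rw [GenSet.mem_added, Finset.mem_singleton]
  exact addedV_injective.eq_iff

end GenSets

/-! ### Remainder projections and the dilated family -/

namespace CKFamily

variable {G : Ultragraph.{u}} (g : G.EmitterListing) {A : Type*} [NonUnitalRing A] [StarRing A]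
  (F : G.CKFamily A)

open Classical in
/-- The range projection of the `n`-th edge listed at `v`, or zero if `v` is a sink. -/
noncomputable def listedProj (v : {v : G.V // G.IsSingular v}) (n : ℕ) : A :=
  if h : G.IsInfiniteEmitter v.1 then
    F.s (g ⟨v.1, h⟩ n).1 * star (F.s (g ⟨v.1, h⟩ n).1) else 0

/-- The projection `p_v` minus the range projections of the first `n` edges listed at `v`. -/
noncomputable def remProj (v : {v : G.V // G.IsSingular v}) (n : ℕ) : A :=
  F.p (G.vert v.1) - ∑ j ∈ Finset.range n, F.listedProj g v j

theorem listedProj_emitter (v : {v : G.V // G.IsInfiniteEmitter v}) (n : ℕ) :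
    F.listedProj g (emitterSingular v) n = F.s (g v n).1 * star (F.s (g v n).1) := dif_pos v.2

theorem listedProj_sink {v : {v : G.V // G.IsSingular v}} (hv : ¬ G.IsInfiniteEmitter v.1)
    (n : ℕ) : F.listedProj g v n = 0 := dif_neg hv

variable {g} in
/-- A singular vertex is an infinite emitter or a sink. -/
theorem _root_.Ultragraph.singular_cases {P : {v : G.V // G.IsSingular v} → Prop}
    (emitter : ∀ v, P (emitterSingular v)) (sink : ∀ v, ¬ G.IsInfiniteEmitter v.1 → P v)
    (v : {v : G.V // G.IsSingular v}) : P v := by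
  by_cases h : G.IsInfiniteEmitter v.1
  · exact emitter ⟨v.1, h⟩
  · exact sink v h

theorem star_listedProj (v : {v : G.V // G.IsSingular v}) (n : ℕ) :
    star (F.listedProj g v n) = F.listedProj g v n := by
  induction v using singular_cases with
  | emitter v => rw [listedProj_emitter, star_mul, star_star]
  | sink v hv => rw [listedProj_sink g F hv, star_zero]

theorem p_mul_listedProj (v : {v : G.V // G.IsSingular v}) (n : ℕ) :
    F.p (G.vert v.1) * F.listedProj g v n = F.listedProj g v n := by
  induction v using singular_cases with
  | emitter v =>
    have := F.final_le (g v n).1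
    rw [(g v n).2] at this
    rw [listedProj_emitter]
    exact this
  | sink v hv => rw [listedProj_sink g F hv, mul_zero]

theorem listedProj_mul_s (v : {v : G.V // G.IsInfiniteEmitter v}) (n m : ℕ) :
    F.listedProj g (emitterSingular v) n * F.s (g v m).1 =
      if n = m then F.s (g v m).1 else 0 := by
  rw [listedProj_emitter]
  split_ifs with h
  · rw [h, F.partialIsometry]
  · rw [mul_assoc, F.orthogonal_ranges _ _ fun h' => h (listed_inj g h').2, mul_zero]

theorem listedProj_mul_listedProj (v : {v : G.V // G.IsSingular v}) (n m : ℕ) :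
    F.listedProj g v n * F.listedProj g v m = if n = m then F.listedProj g v m else 0 := by
  induction v using singular_cases with
  | emitter v =>
    rw [listedProj_emitter g F v m, ← mul_assoc, listedProj_mul_s, ite_mul, zero_mul]
  | sink v hv => simp [listedProj_sink g F hv]

theorem remProj_zero (v : {v : G.V // G.IsSingular v}) :
    F.remProj g v 0 = F.p (G.vert v.1) := by simp [remProj]

theorem remProj_succ_add (v : {v : G.V // G.IsSingular v}) (n : ℕ) :
    F.remProj g v (n + 1) + F.listedProj g v n = F.remProj g v n := by
  rw [remProj, remProj, Finset.sum_range_succ]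
  abel

theorem star_remProj (v : {v : G.V // G.IsSingular v}) (n : ℕ) :
    star (F.remProj g v n) = F.remProj g v n := by
  simp only [remProj, star_sub, star_sum, F.star_p, star_listedProj]

theorem p_mul_remProj (v : {v : G.V // G.IsSingular v}) (n : ℕ) :
    F.p (G.vert v.1) * F.remProj g v n = F.remProj g v n := by
  simp only [remProj, mul_sub, Finset.mul_sum, F.p_mul_self, p_mul_listedProj]

theorem remProj_mul_p (v : {v : G.V // G.IsSingular v}) (n : ℕ) :
    F.remProj g v n * F.p (G.vert v.1) = F.remProj g v n := by
  have := congrArg star (F.p_mul_remProj g v n)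
  rwa [star_mul, star_remProj, F.star_p] at this

/-- The listed range projections are mutually orthogonal and lie under `p_v`; exactly those with
index below `n` have been subtracted. -/
theorem remProj_mul_listedProj (v : {v : G.V // G.IsSingular v}) (n m : ℕ) :
    F.remProj g v n * F.listedProj g v m = if m < n then 0 else F.listedProj g v m := by
  simp only [remProj, sub_mul, Finset.sum_mul, p_mul_listedProj, listedProj_mul_listedProj,
    Finset.sum_ite_eq', Finset.mem_range]
  split_ifs <;> simp

theorem remProj_mul_self (v : {v : G.V // G.IsSingular v}) (n : ℕ) :
    F.remProj g v n * F.remProj g v n = F.remProj g v n := by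
  conv_lhs => rhs; rw [remProj]
  rw [mul_sub, remProj_mul_p, Finset.mul_sum, Finset.sum_eq_zero, sub_zero]
  intro j hj
  rw [remProj_mul_listedProj, if_pos (Finset.mem_range.1 hj)]

theorem remProj_mul_remProj_succ (v : {v : G.V // G.IsSingular v}) (n : ℕ) :
    F.remProj g v n * F.remProj g v (n + 1) = F.remProj g v (n + 1) := by
  rw [eq_sub_of_add_eq (F.remProj_succ_add g v n), mul_sub, remProj_mul_self,
    remProj_mul_listedProj, if_neg (lt_irrefl n)]

theorem remProj_mul_s (v : {v : G.V // G.IsInfiniteEmitter v}) (n m : ℕ) :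
    F.remProj g (emitterSingular v) n * F.s (g v m).1 = if m < n then 0 else F.s (g v m).1 := by
  have : F.s (g v m).1 = F.listedProj g (emitterSingular v) m * F.s (g v m).1 := by
    rw [listedProj_mul_s, if_pos rfl]
  rw [this, ← mul_assoc, remProj_mul_listedProj]
  split_ifs <;> simp

theorem remProj_mul_of_p_mul_eq_zero {v : {v : G.V // G.IsSingular v}} {a : A}
    (h : F.p (G.vert v.1) * a = 0) (n : ℕ) : F.remProj g v n * a = 0 := by
  rw [← remProj_mul_p, mul_assoc, h, mul_zero]

/-- The summand in which the vertex `v_n` lives. -/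
def tailLoc (v : {v : G.V // G.IsSingular v}) : ℕ → Option ({v : G.V // G.IsSingular v} × ℕ)
  | 0 => none
  | n + 1 => some (v, n)

/-- Only the position is recovered: at position zero all singular vertices share the summand `none`.
-/
theorem tailLoc_eq {v v' : {v : G.V // G.IsSingular v}} {n n' : ℕ}
    (h : tailLoc v n = tailLoc v' n') : n = n' := by
  match n, n', h with
  | 0, 0, _ => rfl
  | n + 1, n' + 1, h =>
    exact congrArg (· + 1) (Prod.ext_iff.1 (Option.some.inj h)).2

/-- The summand in which the source of an edge lives. -/
def sourceLoc : (G.desingularization g).E → Option ({v : G.V // G.IsSingular v} × ℕ)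
  | .inl _ => none
  | .inr (.inl (v, n)) => tailLoc v n
  | .inr (.inr (v, n)) => tailLoc (emitterSingular v) n

/-- The summand in which the range of an edge lives. -/
def rangeLoc : (G.desingularization g).E → Option ({v : G.V // G.IsSingular v} × ℕ)
  | .inl _ => none
  | .inr (.inl (v, n)) => tailLoc v (n + 1)
  | .inr (.inr _) => none

/-- The nonzero matrix entry of the partial isometry of an edge. -/
noncomputable def entry : (G.desingularization g).E → A
  | .inl e => F.s e.1
  -- The index is that of the target `v_{n+1}`; in the summand of the source `v_n` this is a
  -- subprojection of `R_n`.
  | .inr (.inl (v, n)) => F.remProj g v (n + 1)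
  | .inr (.inr (v, n)) => F.s (g v n).1

theorem entry_keptEdge (e) : F.entry g (keptEdge g e) = F.s e.1 := rfl

theorem entry_tailEdge (v n) : F.entry g (tailEdge g v n) = F.remProj g v (n + 1) := rfl

theorem entry_emitEdge (v n) : F.entry g (emitEdge g v n) = F.s (g v n).1 := rfl

theorem entry_partialIsometry (e : (G.desingularization g).E) :
    F.entry g e * star (F.entry g e) * F.entry g e = F.entry g e := by
  induction e using edge_cases with
  | kept e => exact F.partialIsometry _
  | tail v n => rw [entry_tailEdge, star_remProj, remProj_mul_self, remProj_mul_self]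
  | emit v n => exact F.partialIsometry _

theorem remProj_mul_entry_kept (v : {v : G.V // G.IsSingular v}) (n : ℕ)
    (e : {e : G.E // ¬ G.IsInfiniteEmitter (G.s e)}) : F.remProj g v n * F.s e.1 = 0 :=
  F.remProj_mul_of_p_mul_eq_zero g (F.p_vert_mul_s_of_ne fun h =>
    keptEdge_source_not_singular e (h ▸ v.2)) n

/-- At the same `v`, the remainder `R_{n+1}` already omits the range of `g_n`; this makes the two
edges leaving `v_n` orthogonal. -/
theorem remProj_succ_mul_entry_emit (v : {v : G.V // G.IsSingular v})
    (v' : {v : G.V // G.IsInfiniteEmitter v}) (n : ℕ) :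
    F.remProj g v (n + 1) * F.s (g v' n).1 = 0 := by
  by_cases h : v = emitterSingular v'
  · subst h
    rw [remProj_mul_s, if_pos n.lt_succ_self]
  · refine F.remProj_mul_of_p_mul_eq_zero g (F.p_vert_mul_s_of_ne fun h' => h ?_) _
    exact Subtype.ext (h'.trans (g v' n).2)

/-- Edges with sources in different summands are orthogonal for free, so only a shared summand is in
question. The hypothesis on locations is used to match tail positions whenever a tail edge meets a
tail or emitting edge. -/
theorem star_entry_mul_entry {e f : (G.desingularization g).E} (hne : e ≠ f)
    (hloc : sourceLoc g e = sourceLoc g f) : star (F.entry g e) * F.entry g f = 0 := by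
  have hstar : ∀ {a b : A}, star a * b = 0 → star b * a = 0 := fun h => by
    have := congrArg star h
    rwa [star_mul, star_star, star_zero] at this
  induction e using edge_cases with
  | kept e =>
    induction f using edge_cases with
    | kept f => exact F.orthogonal_ranges _ _ fun h => hne (congrArg _ (Subtype.ext h))
    | tail v n =>
      apply hstar
      rw [entry_tailEdge, star_remProj]
      exact F.remProj_mul_entry_kept g v _ e
    | emit v n => exact F.orthogonal_ranges _ _ (listed_ne_kept g v n e).symm
  | tail v n =>
    rw [entry_tailEdge, star_remProj]
    induction f using edge_cases with
    | kept f => exact F.remProj_mul_entry_kept g v _ f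
    | tail v' n' =>
      obtain rfl := tailLoc_eq hloc
      refine F.remProj_mul_of_p_mul_eq_zero g ?_ _
      rw [entry_tailEdge, ← p_mul_remProj, ← mul_assoc, F.p_vert_mul_p_vert, zero_mul]
      exact fun h => hne (congrArg (tailEdge g · n) (Subtype.ext h))
    | emit v' n' =>
      obtain rfl := tailLoc_eq hloc
      exact F.remProj_succ_mul_entry_emit g v v' n
  | emit v n =>
    induction f using edge_cases with
    | kept f => exact F.orthogonal_ranges _ _ (listed_ne_kept g v n f)
    | tail v' n' =>
      obtain rfl := tailLoc_eq hloc
      apply hstar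
      rw [entry_tailEdge, star_remProj]
      exact F.remProj_succ_mul_entry_emit g v' v n
    | emit v' n' =>
      refine F.orthogonal_ranges _ _ fun h => hne ?_
      obtain ⟨rfl, rfl⟩ := listed_inj g h
      rfl

section Dilate

variable {g} [Module ℂ A] {B : Type*} [NonUnitalRing B] [StarRing B] [Module ℂ B]
  (M : MatrixSystem (Option ({v : G.V // G.IsSingular v} × ℕ)) A B)

/-- The partial isometries of the dilated family. -/
noncomputable def dilateS (e : (G.desingularization g).E) : B :=
  M.toFun (sourceLoc g e) (rangeLoc g e) (F.entry g e)

/-- The projections of the dilated family. -/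
noncomputable def dilateP (X : (G.desingularization g).GenSet) : B :=
  M.toFun none none (F.p X.base) +
    ∑ y ∈ X.added, M.toFun (some y) (some y) (F.remProj g y.1 (y.2 + 1))

theorem dilateP_toDesing (X : G.GenSet) :
    F.dilateP M (X.toDesing g) = M.toFun none none (F.p X) := by
  rw [dilateP, GenSet.base_toDesing, GenSet.added_toDesing, Finset.sum_empty, add_zero]

theorem dilateP_vert_inclV (v : G.V) :
    F.dilateP M ((G.desingularization g).vert (G.inclV g v)) =
      M.toFun none none (F.p (G.vert v)) := by
  rw [← toDesing_vert, dilateP_toDesing]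

theorem dilateP_vert_tailVert (v : {v : G.V // G.IsSingular v}) (n : ℕ) :
    F.dilateP M ((G.desingularization g).vert (tailVert g v n)) =
      M.toFun (tailLoc v n) (tailLoc v n) (F.remProj g v n) := by
  cases n with
  | zero => rw [tailVert_zero, dilateP_vert_inclV, remProj_zero, tailLoc]
  | succ n =>
    change F.dilateP M ((G.desingularization g).vert (addedV g (v, n))) = _
    rw [dilateP, base_vert_addedV, added_vert_addedV, F.p_empty, map_zero, zero_add,
      Finset.sum_singleton, tailLoc]

theorem star_dilateP (X : (G.desingularization g).GenSet) :
    star (F.dilateP M X) = F.dilateP M X := by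
  simp only [dilateP, star_add, star_sum, M.star_eq, F.star_p, star_remProj]

theorem dilateP_mul_dilateP (X Y : (G.desingularization g).GenSet) :
    F.dilateP M X * F.dilateP M Y =
      F.dilateP M ⟨X.set ∩ Y.set, X.isGenSet.inter Y.isGenSet⟩ := by
  classical
  have hadd : GenSet.added ⟨X.set ∩ Y.set, X.isGenSet.inter Y.isGenSet⟩ = X.added ∩ Y.added := by
    ext y
    simp only [Finset.mem_inter, GenSet.mem_added, Set.mem_inter_iff]
  have h1 : ∀ y, M.toFun none none (F.p X.base) *
      M.toFun (some y) (some y) (F.remProj g y.1 (y.2 + 1)) = 0 := fun y =>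
    M.mul_ne _ _ _ _ _ _ (Option.some_ne_none y).symm
  have h2 : ∀ y, M.toFun (some y) (some y) (F.remProj g y.1 (y.2 + 1)) *
      M.toFun none none (F.p Y.base) = 0 := fun y =>
    M.mul_ne _ _ _ _ _ _ (Option.some_ne_none y)
  have h3 : ∀ y z, M.toFun (some y) (some y) (F.remProj g y.1 (y.2 + 1)) *
      M.toFun (some z) (some z) (F.remProj g z.1 (z.2 + 1)) =
        if y = z then M.toFun (some y) (some y) (F.remProj g y.1 (y.2 + 1)) else 0 := fun y z => by
    split_ifs with h
    · rw [← h, M.mul_same, remProj_mul_self]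
    · exact M.mul_ne _ _ _ _ _ _ fun h' => h (Option.some.inj h')
  simp only [dilateP, add_mul, mul_add, Finset.mul_sum, Finset.sum_mul, M.mul_same, h1, h2, h3,
    Finset.sum_const_zero, add_zero, zero_add, hadd, F.p_inter]
  congr 1
  rw [Finset.sum_comm]
  simp only [Finset.sum_ite_eq, Finset.sum_ite_mem]

theorem dilateP_union (X Y : (G.desingularization g).GenSet) :
    F.dilateP M ⟨X.set ∪ Y.set, X.isGenSet.union Y.isGenSet⟩ = F.dilateP M X + F.dilateP M Y -
      F.dilateP M ⟨X.set ∩ Y.set, X.isGenSet.inter Y.isGenSet⟩ := by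
  classical
  have hinter : GenSet.added ⟨X.set ∩ Y.set, X.isGenSet.inter Y.isGenSet⟩ =
      X.added ∩ Y.added := by
    ext y
    simp only [Finset.mem_inter, GenSet.mem_added, Set.mem_inter_iff]
  have hunion : GenSet.added ⟨X.set ∪ Y.set, X.isGenSet.union Y.isGenSet⟩ =
      X.added ∪ Y.added := by
    ext y
    simp only [Finset.mem_union, GenSet.mem_added, Set.mem_union]
  have hsum := Finset.sum_union_inter (s₁ := X.added) (s₂ := Y.added)
    (f := fun y => M.toFun (some y) (some y) (F.remProj g y.1 (y.2 + 1)))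
  have hp := F.p_union X.base Y.base
  simp only [dilateP, hinter, hunion]
  rw [eq_sub_of_add_eq hsum]
  have hb : GenSet.base ⟨X.set ∪ Y.set, X.isGenSet.union Y.isGenSet⟩ =
    ⟨X.base.set ∪ Y.base.set, X.base.isGenSet.union Y.base.isGenSet⟩ := rfl
  have hb' : GenSet.base ⟨X.set ∩ Y.set, X.isGenSet.inter Y.isGenSet⟩ =
    ⟨X.base.set ∩ Y.base.set, X.base.isGenSet.inter Y.base.isGenSet⟩ := rfl
  rw [hb, hb', hp, map_sub, map_add]
  abel

theorem dilateS_mul_star (e : (G.desingularization g).E) :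
    F.dilateS M e * star (F.dilateS M e) =
      M.toFun (sourceLoc g e) (sourceLoc g e) (F.entry g e * star (F.entry g e)) := by
  rw [dilateS, M.star_eq, M.mul_same]

theorem star_dilateS_mul_self (e : (G.desingularization g).E) :
    star (F.dilateS M e) * F.dilateS M e = F.dilateP M ((G.desingularization g).rng e) := by
  rw [dilateS, M.star_eq, M.mul_same]
  induction e using edge_cases with
  | kept e =>
    rw [entry_keptEdge, F.initial, rng_keptEdge, dilateP_toDesing]
    rfl
  | tail v n =>
    rw [entry_tailEdge, star_remProj, remProj_mul_self, rng_tailEdge, dilateP_vert_tailVert]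
    rfl
  | emit v n =>
    rw [entry_emitEdge, F.initial, rng_emitEdge, dilateP_toDesing]
    rfl

theorem dilateP_mul_dilateS (e : (G.desingularization g).E) :
    F.dilateP M ((G.desingularization g).vert ((G.desingularization g).s e)) * F.dilateS M e =
      F.dilateS M e := by
  induction e using edge_cases with
  | kept e =>
    rw [source_keptEdge, dilateP_vert_inclV]
    exact (M.mul_same _ _ _ _ _).trans (congrArg _ (F.p_vert_mul_s _))
  | tail v n =>
    rw [source_tailEdge, dilateP_vert_tailVert]
    exact (M.mul_same _ _ _ _ _).trans (congrArg _ (F.remProj_mul_remProj_succ g v n))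
  | emit v n =>
    rw [source_emitEdge, dilateP_vert_tailVert]
    refine (M.mul_same _ _ _ _ _).trans (congrArg _ ?_)
    -- `R_n` subtracts only the indices below `n`, so it still contains the range of `g_n`, the edge
    -- leaving at `v_n`.
    rw [entry_emitEdge, remProj_mul_s, if_neg (lt_irrefl n)]

theorem dilate_regular_sum (x : (G.desingularization g).V)
    (hfin : {e | (G.desingularization g).s e = x}.Finite)
    (hne : {e | (G.desingularization g).s e = x}.Nonempty) :
    F.dilateP M ((G.desingularization g).vert x) =
      ∑ e ∈ hfin.toFinset, F.dilateS M e * star (F.dilateS M e) := by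
  classical
  have htail : ∀ v n, x = tailVert g v n → F.dilateP M ((G.desingularization g).vert x) =
      ∑ e ∈ hfin.toFinset, F.dilateS M e * star (F.dilateS M e) := by
    rintro v n rfl
    rw [dilateP_vert_tailVert]
    induction v using singular_cases with
    | emitter v =>
      have hset := edgesFrom_tailVert_of_emitter g v n
      have : hfin.toFinset = {tailEdge g (emitterSingular v) n, emitEdge g v n} := by
        ext; simp [hset]
      -- The two edges at `v_n` contribute `R_{n+1}` and `s_{g_n} s_{g_n}^*`, which add up to `R_n`.
      rw [this, Finset.sum_pair (tailEdge_ne_emitEdge g _ _ _ _), dilateS_mul_star,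
        dilateS_mul_star, entry_tailEdge, entry_emitEdge, star_remProj, remProj_mul_self,
        ← listedProj_emitter, ← remProj_succ_add, map_add]
      rfl
    | sink v hv =>
      have hset := edgesFrom_tailVert_of_sink g v hv n
      have : hfin.toFinset = {tailEdge g v n} := by ext; simp [hset]
      rw [this, Finset.sum_singleton, dilateS_mul_star, entry_tailEdge, star_remProj,
        remProj_mul_self, ← remProj_succ_add, listedProj_sink g F hv, add_zero]
      rfl
  induction x using vert_cases with
  | tail v n => exact htail v (n + 1) rfl
  | incl v =>
    by_cases hv : G.IsSingular v
    · exact htail ⟨v, hv⟩ 0 rfl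
    have hset := edgesFrom_inclV_of_not_singular g hv
    have hk : ∀ e, G.s e = v → ¬ G.IsInfiniteEmitter (G.s e) := fun e he h => hv (.inr (he ▸ h))
    have hne' : {e | G.s e = v}.Nonempty := by
      obtain ⟨e, he⟩ := hne
      rw [hset] at he
      obtain ⟨e, he, rfl⟩ := he
      exact ⟨e.1, he⟩
    have hfin' : {e | G.s e = v}.Finite := Set.not_infinite.1 fun h => hv (.inr h)
    rw [dilateP_vert_inclV, F.regular_sum v hfin' hne', map_sum]
    refine Finset.sum_bij (fun e he => keptEdge g ⟨e, hk e (hfin'.mem_toFinset.1 he)⟩) ?_ ?_ ?_ ?_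
    · intro e he
      rw [hfin.mem_toFinset, hset]
      exact ⟨_, hfin'.mem_toFinset.1 he, rfl⟩
    · intro e _ f _ h
      exact congrArg Subtype.val (keptEdge_injective g h)
    · intro f hf
      rw [hfin.mem_toFinset, hset] at hf
      obtain ⟨e, he, rfl⟩ := hf
      exact ⟨e.1, hfin'.mem_toFinset.2 he, rfl⟩
    · intro e he
      rw [dilateS_mul_star]
      rfl

/-- The dilation of a family of `G` to a family of the desingularization. -/
noncomputable def dilate : (G.desingularization g).CKFamily B where
  s := F.dilateS M
  p := F.dilateP M
  partialIsometry e := by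
    rw [dilateS_mul_star, dilateS, M.mul_same, entry_partialIsometry]
  orthogonal_ranges e f hne := by
    rw [dilateS, dilateS, M.star_eq]
    by_cases h : sourceLoc g e = sourceLoc g f
    · rw [h, M.mul_same, F.star_entry_mul_entry g hne h, map_zero]
    · exact M.mul_ne _ _ _ _ _ _ h
  projection X := by
    refine ⟨?_, F.star_dilateP M X⟩
    rw [IsIdempotentElem, dilateP_mul_dilateP]
    exact congrArg _ (GenSet.ext (Set.inter_self _))
  p_empty := by
    have : (⟨∅, .empty⟩ : (G.desingularization g).GenSet) = GenSet.toDesing g ⟨∅, .empty⟩ :=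
      GenSet.ext (Set.image_empty _).symm
    rw [this, dilateP_toDesing, F.p_empty, map_zero]
  p_inter := F.dilateP_mul_dilateP M
  p_union := F.dilateP_union M
  initial := F.star_dilateS_mul_self M
  final_le e := by rw [← mul_assoc, dilateP_mul_dilateS]
  regular_sum := F.dilate_regular_sum M

theorem dilate_tailPath (v : {v : G.V // G.IsSingular v}) (n : ℕ) :
    (F.dilate (g := g) M).tailPath v n = M.toFun none (tailLoc v n) (F.remProj g v n) := by
  induction n with
  | zero => exact F.dilateP_vert_tailVert M v 0
  | succ n ih =>
    rw [tailPath_succ, ih]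
    exact (M.mul_same _ _ _ _ _).trans (congrArg _ (F.remProj_mul_remProj_succ g v n))

/-- The tail path contributes `R_n` from the summand of `v_n` to `none`, and `R_n` fixes `s_{g_n}`.
The path thus returns the original edge on the first summand. -/
theorem dilate_exitPath (v : {v : G.V // G.IsInfiniteEmitter v}) (n : ℕ) :
    (F.dilate (g := g) M).exitPath v n = M.toFun none none (F.s (g v n).1) := by
  rw [exitPath, dilate_tailPath]
  refine (M.mul_same _ _ _ _ _).trans (congrArg _ ?_)
  rw [entry_emitEdge, remProj_mul_s, if_neg (lt_irrefl n)]

theorem dilate_restrict_s (e : G.E) :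
    (F.dilate (g := g) M).restrict.s e = M.diag none (F.s e) := by
  change (F.dilate (g := g) M).restrictS e = M.toFun none none (F.s e)
  induction e using edge_kept_or_listed g with
  | kept e => rw [restrictS_kept]; rfl
  | listed v n => rw [restrictS_listed, dilate_exitPath]

theorem dilate_restrict_p (X : G.GenSet) :
    (F.dilate (g := g) M).restrict.p X = M.diag none (F.p X) :=
  F.dilateP_toDesing M X

end Dilate

end CKFamily

/-! ### The homomorphism from `C*(G)` to the algebra of the desingularization -/

section Naturality

variable {G : Ultragraph.{u}} {g : G.EmitterListing} {A B : Type*} [NonUnitalRing A] [StarRing A]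
  [Module ℂ A] [NonUnitalRing B] [StarRing B] [Module ℂ B]
  {F : (G.desingularization g).CKFamily A} {F' : (G.desingularization g).CKFamily B}
  {ψ : A →⋆ₙₐ[ℂ] B}

theorem CKFamily.map_tailPath (hs : ∀ e, ψ (F.s e) = F'.s e) (hp : ∀ X, ψ (F.p X) = F'.p X)
    (v : {v : G.V // G.IsSingular v}) (n : ℕ) : ψ (F.tailPath v n) = F'.tailPath v n := by
  induction n with
  | zero => exact hp _
  | succ n ih => rw [tailPath_succ, tailPath_succ, map_mul, ih, hs]

theorem CKFamily.map_restrict_s (hs : ∀ e, ψ (F.s e) = F'.s e) (hp : ∀ X, ψ (F.p X) = F'.p X)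
    (e : G.E) : ψ (F.restrict.s e) = F'.restrict.s e := by
  change ψ (F.restrictS e) = F'.restrictS e
  induction e using edge_kept_or_listed g with
  | kept e => rw [restrictS_kept, restrictS_kept, hs]
  | listed v n =>
    rw [restrictS_listed, restrictS_listed, exitPath, exitPath, map_mul, map_tailPath hs hp, hs]

end Naturality

section Hom

variable (G : Ultragraph.{u}) (g : G.EmitterListing)

theorem continuous_starHom {A B : Type*} [NonUnitalCStarAlgebra A] [NonUnitalCStarAlgebra B]
    (φ : A →⋆ₙₐ[ℂ] B) : Continuous φ :=
  AddMonoidHomClass.continuous_of_bound φ 1 fun a => by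
    simpa only [one_mul] using NonUnitalStarAlgHom.norm_apply_le φ a

variable {G} in
/-- The restriction to `G` of a family of the desingularization on a Hilbert space. -/
noncomputable def HilbertFamily.restrict {g : G.EmitterListing}
    (ω : (G.desingularization g).HilbertFamily) : G.HilbertFamily :=
  ⟨ω.H, ω.fam.restrict⟩

/-- The product of the representations of `C*(G)` given by the restrictions of all families of
the desingularization. -/
noncomputable def restrictionRep : G.CStar →⋆ₙₐ[ℂ] (G.desingularization g).Ambient where
  toFun a := ⟨fun ω => G.rep ω.restrict a, memℓp_infty ⟨‖a‖, by
    rintro _ ⟨ω, rfl⟩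
    exact NonUnitalStarAlgHom.norm_apply_le (G.rep ω.restrict) a⟩⟩
  map_smul' c a := lp.ext (funext fun ω => map_smul (G.rep ω.restrict) c a)
  map_zero' := lp.ext (funext fun ω => map_zero (G.rep ω.restrict))
  map_add' a b := lp.ext (funext fun ω => map_add (G.rep ω.restrict) a b)
  map_mul' a b := lp.ext (funext fun ω => map_mul (G.rep ω.restrict) a b)
  map_star' a := lp.ext (funext fun ω => map_star (G.rep ω.restrict) a)

theorem restrictionRep_s (e : G.E) : restrictionRep G g (G.gen.s e) =
    (G.desingularization g).incl ((G.desingularization g).gen.restrict.s e) :=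
  lp.ext (funext fun ω => (CKFamily.map_restrict_s (ψ := (G.desingularization g).rep ω)
    (F' := ω.fam) (fun _ => rfl) (fun _ => rfl) e).symm)

theorem restrictionRep_p (X : G.GenSet) : restrictionRep G g (G.gen.p X) =
    (G.desingularization g).incl ((G.desingularization g).gen.restrict.p X) := rfl

/-- The images of the generators lie in `C*(F)`, and the preimage of this closed subalgebra is a
closed subalgebra of `C*(G)`. -/
theorem restrictionRep_mem (a : G.CStar) :
    restrictionRep G g a ∈ (G.desingularization g).cstarSub := by
  have htop := G.eq_top_of_gen_mem
    ((G.desingularization g).cstarSub.comap (restrictionRep G g))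
    ((NonUnitalStarSubalgebra.isClosed_topologicalClosure _).preimage
      (continuous_starHom (restrictionRep G g)))
    (fun e => by
      rw [NonUnitalStarSubalgebra.mem_comap, restrictionRep_s]
      exact Subtype.property _)
    (fun X => by
      rw [NonUnitalStarSubalgebra.mem_comap, restrictionRep_p]
      exact Subtype.property _)
  have ha : a ∈ (G.desingularization g).cstarSub.comap (restrictionRep G g) := htop ▸ trivial
  exact ha

/-- The homomorphism from `C*(G)` to the algebra of the desingularization. -/
noncomputable def toDesingHom : G.CStar →⋆ₙₐ[ℂ] (G.desingularization g).CStar where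
  toFun a := ⟨restrictionRep G g a, restrictionRep_mem G g a⟩
  map_smul' c a := Subtype.ext (map_smul (restrictionRep G g) c a)
  map_zero' := Subtype.ext (map_zero (restrictionRep G g))
  map_add' a b := Subtype.ext (map_add (restrictionRep G g) a b)
  map_mul' a b := Subtype.ext (map_mul (restrictionRep G g) a b)
  map_star' a := Subtype.ext (map_star (restrictionRep G g) a)

theorem toDesingHom_s (e : G.E) :
    toDesingHom G g (G.gen.s e) = (G.desingularization g).gen.restrict.s e :=
  Subtype.ext (restrictionRep_s G g e)

theorem toDesingHom_p (X : G.GenSet) :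
    toDesingHom G g (G.gen.p X) = (G.desingularization g).gen.restrict.p X :=
  Subtype.ext (restrictionRep_p G g X)

theorem rep_toDesingHom (ω : (G.desingularization g).HilbertFamily) (a : G.CStar) :
    (G.desingularization g).rep ω (toDesingHom G g a) = G.rep ω.restrict a := rfl

/-- The dilation of a family of `G` on a Hilbert space to the desingularization. -/
noncomputable def HilbertFamily.dilate {G : Ultragraph.{u}} (g : G.EmitterListing)
    (η : G.HilbertFamily) : (G.desingularization g).HilbertFamily :=
  -- The index set lies in the universe of the Hilbert spaces, so the dilation is again one of the
  -- families that define the ambient product.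
  ⟨HilbertSum (Option ({v : G.V // G.IsSingular v} × ℕ)) η.H,
    η.fam.dilate (hilbertMatrixSystem _ η.H)⟩

/-- The restriction of the dilation of a family represents `C*(G)` on one of the summands. -/
theorem rep_restrict_dilate (η : G.HilbertFamily) (a : G.CStar) :
    G.rep (η.dilate g).restrict a =
      (hilbertMatrixSystem (Option ({v : G.V // G.IsSingular v} × ℕ)) η.H).diag none
        (G.rep η a) := by
  have h := (G.existsUnique_rep (η.dilate g).restrict).unique
    (y₁ := G.rep (η.dilate g).restrict)
    (y₂ := ((hilbertMatrixSystem (Option ({v : G.V // G.IsSingular v} × ℕ)) η.H).diag none).comp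
      (G.rep η))
    ⟨fun _ => rfl, fun _ => rfl⟩
    ⟨fun e => (η.fam.dilate_restrict_s (g := g) (hilbertMatrixSystem _ η.H) e).symm, fun X => (η.fam.dilate_restrict_p (g := g) (hilbertMatrixSystem _ η.H) X).symm⟩
  exact DFunLike.congr_fun h a

/-- Each coordinate of `C*(G)` can be read off from the image, as the `none` diagonal entry of the
coordinate at the dilated family. -/
theorem toDesingHom_injective : Function.Injective (toDesingHom G g) := by
  intro a b hab
  refine CStar.ext_rep fun η => hilbertMatrixSystem_diag_injective
    (Option ({v : G.V // G.IsSingular v} × ℕ)) η.H none ?_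
  rw [← rep_restrict_dilate, ← rep_restrict_dilate, ← rep_toDesingHom, ← rep_toDesingHom, hab]

end Hom

/-! ### The range of the homomorphism -/

section Connectors

variable {G : Ultragraph.{u}} {g : G.EmitterListing} {A : Type*} [NonUnitalCStarAlgebra A]
  (F : (G.desingularization g).CKFamily A)

/-- The projections `q_X` for `X` in `𝒢⁰`, and the partial isometries of the paths along tails:
the elements that connect the corner with the rest of the algebra. -/
def CKFamily.connector : G.GenSet ⊕ ({v : G.V // G.IsSingular v} × ℕ) → A
  | .inl X => F.p (X.toDesing g)
  | .inr (v, n) => F.tailPath v (n + 1)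

/-- The set of vertices at which a connector ends. -/
def connectorSet (g : G.EmitterListing) :
    G.GenSet ⊕ ({v : G.V // G.IsSingular v} × ℕ) → (G.desingularization g).GenSet
  | .inl X => X.toDesing g
  | .inr (v, n) => (G.desingularization g).vert (tailVert g v (n + 1))

/-- The connector that ends at a vertex. -/
def vertConnector (g : G.EmitterListing) :
    (G.desingularization g).V → G.GenSet ⊕ ({v : G.V // G.IsSingular v} × ℕ)
  | .inl v => .inl (G.vert v)
  | .inr y => .inr y

/-- The connector that ends at the range of an edge. -/
def rangeConnector (g : G.EmitterListing) :
    (G.desingularization g).E → G.GenSet ⊕ ({v : G.V // G.IsSingular v} × ℕ)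
  | .inl e => .inl (G.rng e.1)
  | .inr (.inl y) => .inr y
  | .inr (.inr (v, n)) => .inl (G.rng (g v n).1)

theorem connectorSet_vertConnector (x : (G.desingularization g).V) :
    connectorSet g (vertConnector g x) = (G.desingularization g).vert x := by
  induction x using vert_cases with
  | incl v => exact toDesing_vert g v
  | tail v n => rfl

theorem connectorSet_rangeConnector (e : (G.desingularization g).E) :
    connectorSet g (rangeConnector g e) = (G.desingularization g).rng e := by
  induction e using edge_cases with
  | kept e => rfl
  | tail v n => rfl
  | emit v n => rfl

namespace CKFamily

theorem star_connector_mul_self (i) :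
    star (F.connector i) * F.connector i = F.p (connectorSet g i) := by
  match i with
  | .inl X => exact (congrArg (· * _) (F.star_p _)).trans (F.p_mul_self _)
  | .inr (v, n) => exact F.star_tailPath_mul_self v (n + 1)

theorem connector_tailVert (v : {v : G.V // G.IsSingular v}) (n : ℕ) :
    F.connector (vertConnector g (tailVert g v n)) = F.tailPath v n := by
  cases n with
  | zero => exact congrArg F.p (toDesing_vert g v.1)
  | succ n => rfl

/-- A connector followed by `e` vanishes unless it ends at a set containing the source of `e`, and
then it may be replaced by the connector ending at that vertex alone. -/
theorem connector_mul_s (i) (e : (G.desingularization g).E) :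
    F.connector i * F.s e = 0 ∨ F.connector i * F.s e =
      F.connector (vertConnector g ((G.desingularization g).s e)) * F.s e := by
  match i with
  | .inl X =>
    by_cases h : (G.desingularization g).s e ∈ (X.toDesing g).set
    · right
      rw [connector, F.p_mul_s_of_mem h]
      obtain ⟨v, _, hv⟩ := h
      rw [← hv]
      change _ = F.p ((G.vert v).toDesing g) * _
      rw [toDesing_vert, hv, F.p_vert_mul_s]
    · exact .inl (F.p_mul_s_of_notMem h)
  | .inr (v, n) =>
    by_cases h : tailVert g v (n + 1) = (G.desingularization g).s e
    · right
      rw [← h, connector_tailVert]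
      rfl
    · left
      rw [connector, ← F.tailPath_mul_p, mul_assoc, F.p_vert_mul_s_of_ne h, mul_zero]

variable {S : NonUnitalStarSubalgebra ℂ A} (hs : ∀ e, F.restrict.s e ∈ S)
  (hp : ∀ X, F.restrict.p X ∈ S)

include hs in
theorem exitPath_mem (v : {v : G.V // G.IsInfiniteEmitter v}) (n : ℕ) : F.exitPath v n ∈ S := by
  rw [← restrictS_listed]
  exact hs _

include hs hp

/-- Each step down the tail subtracts the range projection of an exit path, or nothing at a sink,
and exit paths are restricted generators. -/
theorem tailPath_mul_star_mem (v : {v : G.V // G.IsSingular v}) (n : ℕ) :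
    F.tailPath v n * star (F.tailPath v n) ∈ S := by
  induction n with
  | zero =>
    rw [tailPath, F.star_p, F.p_mul_self, tailVert_zero, ← toDesing_vert]
    exact hp _
  | succ n ih =>
    induction v using singular_cases with
    | emitter v =>
      rw [eq_sub_of_add_eq (F.tailPath_mul_star_eq_of_emitter v n).symm]
      exact sub_mem ih (mul_mem (F.exitPath_mem hs v n) (star_mem (F.exitPath_mem hs v n)))
    | sink v hv =>
      rw [← F.tailPath_mul_star_eq_of_sink v hv]
      exact ih

theorem connector_mul_star_connector_mem (i j) :
    F.connector i * star (F.connector j) ∈ S := by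
  have h0 : ∀ (X : G.GenSet) v n, F.p (X.toDesing g) * star (F.tailPath v (n + 1)) = 0 := by
    intro X v n
    rw [← F.tailPath_mul_p, star_mul, F.star_p, ← mul_assoc,
      F.p_mul_of_disjoint (toDesing_disjoint_tailVert X v n), zero_mul]
  match i, j with
  | .inl X, .inl Y =>
    rw [connector, connector, F.star_p]
    exact mul_mem (hp X) (hp Y)
  | .inl X, .inr (v, n) =>
    rw [connector, connector, h0]
    exact zero_mem S
  | .inr (v, n), .inl X =>
    have := congrArg star (h0 X v n)
    rw [star_mul, star_star, star_zero] at this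
    rw [connector, connector, this]
    exact zero_mem S
  | .inr (v, n), .inr (v', n') =>
    rw [connector, connector]
    by_cases h : tailVert g v (n + 1) = tailVert g v' (n' + 1)
    · obtain ⟨rfl, hn⟩ := (tailVert_inj g).1 h
      rw [← hn]
      exact F.tailPath_mul_star_mem hs hp v _
    · rw [← F.tailPath_mul_p, ← F.tailPath_mul_p v', star_mul, F.star_p, mul_assoc,
        ← mul_assoc (F.p _), F.p_vert_mul_p_vert h, zero_mul, mul_zero]
      exact zero_mem S

/-- Returning along the connector at the range of `e` leaves zero or one of: a kept generator, a
tail path times its adjoint, an exit path. -/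
theorem connector_mul_s_mul_star_rangeConnector_mem (i) (e : (G.desingularization g).E) :
    F.connector i * F.s e * star (F.connector (rangeConnector g e)) ∈ S := by
  have key : F.connector (vertConnector g ((G.desingularization g).s e)) * F.s e *
      star (F.connector (rangeConnector g e)) ∈ S := by
    induction e using edge_cases with
    | kept e =>
      have h1 : F.connector (vertConnector g ((G.desingularization g).s (keptEdge g e))) *
          F.s (keptEdge g e) = F.s (keptEdge g e) := by
        change F.p ((G.vert (G.s e.1)).toDesing g) * _ = _
        rw [toDesing_vert]
        exact F.p_vert_mul_s (keptEdge g e)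
      have h2 : F.connector (rangeConnector g (keptEdge g e)) =
        F.p ((G.desingularization g).rng (keptEdge g e)) := rfl
      rw [h1, h2, F.star_p, F.s_mul_p_rng, ← restrictS_kept]
      exact hs _
    | tail v n =>
      rw [source_tailEdge, connector_tailVert]
      exact F.tailPath_mul_star_mem hs hp v (n + 1)
    | emit v n =>
      have h2 : F.connector (rangeConnector g (emitEdge g v n)) =
        F.p ((G.desingularization g).rng (emitEdge g v n)) := rfl
      rw [source_emitEdge, connector_tailVert, h2, F.star_p, mul_assoc, F.s_mul_p_rng]
      exact F.exitPath_mem hs v n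
  rcases F.connector_mul_s i e with h | h
  · rw [h, zero_mul]
    exact zero_mem S
  · rwa [h]

theorem connector_mul_s_mul_star_connector_mem (i j) (e : (G.desingularization g).E) :
    F.connector i * F.s e * star (F.connector j) ∈ S := by
  have : F.connector i * F.s e * star (F.connector j) =
      F.connector i * F.s e * star (F.connector (rangeConnector g e)) *
        (F.connector (rangeConnector g e) * star (F.connector j)) := by
    -- Insert `q_{r(e)} = c^* c`, where `c` is the connector at the range of `e`.
    conv_lhs => rw [← F.s_mul_p_rng e, ← connectorSet_rangeConnector, ← star_connector_mul_self]
    simp only [mul_assoc]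
  rw [this]
  exact mul_mem (F.connector_mul_s_mul_star_rangeConnector_mem hs hp i e)
    (F.connector_mul_star_connector_mem hs hp _ j)

end CKFamily

end Connectors

/-! ### Elements whose compressions lie in a subalgebra -/

section Compression

variable {A ι : Type*} [NonUnitalCStarAlgebra A]

/-- The elements `b` with `c i * b * star (c j) ∈ S` for all `i` and `j`. -/
def compressionSet (c : ι → A) (S : NonUnitalStarSubalgebra ℂ A) : Set A :=
  {b | ∀ i j, c i * b * star (c j) ∈ S}

variable {c : ι → A} {S : NonUnitalStarSubalgebra ℂ A}

theorem isClosed_compressionSet (hS : IsClosed (S : Set A)) : IsClosed (compressionSet c S) := by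
  have : compressionSet c S = ⋂ i, ⋂ j, (fun b => c i * b * star (c j)) ⁻¹' (S : Set A) := by
    ext b
    simp only [Set.mem_iInter]
    rfl
  rw [this]
  exact isClosed_iInter fun i => isClosed_iInter fun j => hS.preimage (by fun_prop)

theorem add_mem_compressionSet {a b : A} (ha : a ∈ compressionSet c S)
    (hb : b ∈ compressionSet c S) : a + b ∈ compressionSet c S := fun i j => by
  rw [mul_add, add_mul]
  exact add_mem (ha i j) (hb i j)

theorem zero_mem_compressionSet : (0 : A) ∈ compressionSet c S := fun i j => by
  rw [mul_zero, zero_mul]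
  exact zero_mem S

theorem smul_mem_compressionSet (r : ℂ) {a : A} (ha : a ∈ compressionSet c S) :
    r • a ∈ compressionSet c S := fun i j => by
  rw [mul_smul_comm, smul_mul_assoc]
  exact SMulMemClass.smul_mem r (ha i j)

theorem star_mem_compressionSet {a : A} (ha : a ∈ compressionSet c S) :
    star a ∈ compressionSet c S := fun i j => by
  have := star_mem (ha j i)
  rwa [star_mul, star_mul, star_star, ← mul_assoc] at this

/-- The elements of `compressionSet c S` that multiply it into itself from the left. -/
def compressionSubalgebra (c : ι → A) (S : NonUnitalStarSubalgebra ℂ A) :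
    NonUnitalStarSubalgebra ℂ A where
  -- `compressionSet` need not be closed under products; its left multipliers are, and treating `a`
  -- and `star a` together makes them a `*`-algebra.
  carrier := {a | a ∈ compressionSet c S ∧ ∀ b ∈ compressionSet c S,
    a * b ∈ compressionSet c S ∧ star a * b ∈ compressionSet c S}
  add_mem' := fun ha ha' => ⟨add_mem_compressionSet ha.1 ha'.1, fun b hb => by
    rw [star_add, add_mul, add_mul]
    exact ⟨add_mem_compressionSet (ha.2 b hb).1 (ha'.2 b hb).1,
      add_mem_compressionSet (ha.2 b hb).2 (ha'.2 b hb).2⟩⟩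
  zero_mem' := ⟨zero_mem_compressionSet, fun b hb => by
    rw [star_zero, zero_mul]
    exact ⟨zero_mem_compressionSet, zero_mem_compressionSet⟩⟩
  mul_mem' := fun ha ha' => ⟨(ha.2 _ ha'.1).1, fun b hb => by
    rw [star_mul, mul_assoc, mul_assoc]
    exact ⟨(ha.2 _ (ha'.2 b hb).1).1, (ha'.2 _ (ha.2 b hb).2).2⟩⟩
  smul_mem' := fun r a ha => ⟨smul_mem_compressionSet r ha.1, fun b hb => by
    rw [star_smul, smul_mul_assoc, smul_mul_assoc]
    exact ⟨smul_mem_compressionSet _ (ha.2 b hb).1, smul_mem_compressionSet _ (ha.2 b hb).2⟩⟩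
  star_mem' := fun ha => ⟨star_mem_compressionSet ha.1, fun b hb => by
    rw [star_star]
    exact ⟨(ha.2 b hb).2, (ha.2 b hb).1⟩⟩

theorem isClosed_compressionSubalgebra (hS : IsClosed (S : Set A)) :
    IsClosed (compressionSubalgebra c S : Set A) := by
  have hN := isClosed_compressionSet (c := c) hS
  have : (compressionSubalgebra c S : Set A) = compressionSet c S ∩
      ⋂ b ∈ compressionSet c S, (fun a => a * b) ⁻¹' compressionSet c S ∩
        (fun a => star a * b) ⁻¹' compressionSet c S := by
    ext a
    simp only [Set.mem_inter_iff, Set.mem_iInter]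
    rfl
  rw [this]
  exact hN.inter (isClosed_biInter fun b _ => (hN.preimage (by fun_prop)).inter
    (hN.preimage (by fun_prop)))

end Compression

/-! ### The image of `C*(G)` is the corner -/

section Range

variable {G : Ultragraph.{u}} {g : G.EmitterListing}

/-- A closed `*`-subalgebra that contains the restricted generators contains every compression by
connectors. -/
theorem connector_compression_mem {S : NonUnitalStarSubalgebra ℂ (G.desingularization g).CStar}
    (hS : IsClosed (S : Set (G.desingularization g).CStar))
    (hs : ∀ e, (G.desingularization g).gen.restrict.s e ∈ S)
    (hp : ∀ X, (G.desingularization g).gen.restrict.p X ∈ S) (a : (G.desingularization g).CStar) :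
    a ∈ compressionSet (G.desingularization g).gen.connector S := by
  set F := (G.desingularization g).gen with hF
  have hvert : ∀ x, F.p ((G.desingularization g).vert x) =
      star (F.connector (vertConnector g x)) * F.connector (vertConnector g x) := fun x => by
    rw [F.star_connector_mul_self, connectorSet_vertConnector]
  have hconn := F.connector_mul_star_connector_mem hs hp
  have hsmem := F.connector_mul_s_mul_star_connector_mem hs hp
  have htop : compressionSubalgebra F.connector S = ⊤ := by
    refine eq_top_of_vert_mem_of_s_mem _ _ (isClosed_compressionSubalgebra hS) (fun x => ?_)
      fun e => ?_
    · have hmul : ∀ b ∈ compressionSet F.connector S,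
          F.p ((G.desingularization g).vert x) * b ∈ compressionSet F.connector S := by
        intro b hb i j
        -- With `q_x = c^* c`, the compression splits as `(c_i c^*)(c b c_j^*)`.
        have := mul_mem (hconn i (vertConnector g x)) (hb (vertConnector g x) j)
        rw [hvert]
        simpa only [mul_assoc] using this
      refine ⟨fun i j => ?_, fun b hb => ⟨hmul b hb, ?_⟩⟩
      · have := mul_mem (hconn i (vertConnector g x)) (hconn (vertConnector g x) j)
        rw [← hF, hvert]
        simpa only [mul_assoc] using this
      · rw [← hF, F.star_p]
        exact hmul b hb
    · refine ⟨fun i j => hsmem i j e, fun b hb => ⟨fun i j => ?_, fun i j => ?_⟩⟩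
      · have := mul_mem (hsmem i (rangeConnector g e) e) (hb (rangeConnector g e) j)
        rw [← hF, ← F.s_mul_p_rng, ← connectorSet_rangeConnector, ← F.star_connector_mul_self]
        simpa only [mul_assoc] using this
      · have h1 := star_mem (hsmem (vertConnector g ((G.desingularization g).s e)) i e)
        have := mul_mem h1 (hb (vertConnector g ((G.desingularization g).s e)) j)
        rw [← hF, ← F.star_s_mul_p_vert, hvert]
        simpa only [star_mul, star_star, mul_assoc] using this
  have ha : a ∈ compressionSubalgebra F.connector S := htop ▸ trivial
  exact ha.1

variable {w : ℕ → Option G.V} {h : ℕ → Option G.E} {p : 𝓜(ℂ, (G.desingularization g).CStar)}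

theorem toDesingHom_mem_corner (hp : IsStarProjection p)
    (hlim : StrictlyTendsto (fun n => ((G.desingularization g).gen.initialProj w h n :
      𝓜(ℂ, (G.desingularization g).CStar))) p)
    (hw : ∀ v, ∃ i, w i = some v) (hh : ∀ e, ∃ i, h i = some e) (a : G.CStar) :
    toDesingHom G g a ∈ corner p hp := by
  set F := (G.desingularization g).gen with hF
  have hP := p_toDesing_mem_corner hp hlim hw hh
  have htop := G.eq_top_of_gen_mem ((corner p hp).comap (toDesingHom G g))
    ((isClosed_corner hp).preimage (continuous_starHom (toDesingHom G g)))
    (fun e => by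
      rw [NonUnitalStarSubalgebra.mem_comap, toDesingHom_s, mem_corner_iff]
      have h1 : F.p ((G.vert (G.s e)).toDesing g) * F.restrict.s e = F.restrict.s e := by
        rw [toDesing_vert]
        exact F.p_mul_restrictS e
      have h2 : F.restrict.s e * F.p ((G.rng e).toDesing g) = F.restrict.s e :=
        F.restrict.s_mul_p_rng e
      constructor
      · rw [← hF, ← h1, fst_mul, ((mem_corner_iff hp).1 (hP _)).1]
      · rw [← hF, ← h2, snd_mul, ((mem_corner_iff hp).1 (hP _)).2])
    (fun X => by
      rw [NonUnitalStarSubalgebra.mem_comap, toDesingHom_p]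
      exact hP X)
  have ha : a ∈ (corner p hp).comap (toDesingHom G g) := htop ▸ trivial
  exact ha

theorem corner_subset_range_toDesingHom (hp : IsStarProjection p)
    (hlim : StrictlyTendsto (fun n => ((G.desingularization g).gen.initialProj w h n :
      𝓜(ℂ, (G.desingularization g).CStar))) p)
    {x : (G.desingularization g).CStar} (hx : x ∈ corner p hp) :
    ∃ a, toDesingHom G g a = x := by
  set F := (G.desingularization g).gen with hF
  have hclosed : IsClosed (Set.range (toDesingHom G g)) :=
    (NonUnitalStarAlgHom.isometry (toDesingHom G g)
      (toDesingHom_injective G g)).isClosedEmbedding.isClosed_range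
  have hmem := connector_compression_mem (g := g)
    (S := NonUnitalStarAlgHom.range (toDesingHom G g)) hclosed
    (fun e => ⟨_, toDesingHom_s G g e⟩) (fun X => ⟨_, toDesingHom_p G g X⟩) x
  have hconv := hlim.tendsto_compression (isStarProjection_initialProj w h) x
  obtain ⟨h1, h2⟩ := (mem_corner_iff hp).1 hx
  rw [h2, h1] at hconv
  refine hclosed.mem_of_tendsto hconv (.of_forall fun n => ?_)
  -- The projection `q_{A_n}` is itself a connector, so the compression of `x` by it lies in the
  -- range.
  have := hmem (.inl (G.initialGenSet w h n)) (.inl (G.initialGenSet w h n))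
  rw [CKFamily.connector, CKFamily.star_p, mul_assoc] at this
  exact this

/-- `C*(G)` is isomorphic to the corner cut out by the limit of the `q_{A_n}`. -/
theorem nonempty_starAlgEquiv_corner (hp : IsStarProjection p)
    (hlim : StrictlyTendsto (fun n => ((G.desingularization g).gen.initialProj w h n :
      𝓜(ℂ, (G.desingularization g).CStar))) p)
    (hw : ∀ v, ∃ i, w i = some v) (hh : ∀ e, ∃ i, h i = some e) :
    Nonempty (G.CStar ≃⋆ₐ[ℂ] corner p hp) := by
  refine ⟨StarAlgEquiv.ofBijective (NonUnitalStarAlgHom.codRestrict (toDesingHom G g)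
    (corner p hp) (toDesingHom_mem_corner hp hlim hw hh)) ⟨fun a b hab => ?_, fun x => ?_⟩⟩
  · exact toDesingHom_injective G g (congrArg Subtype.val hab)
  · obtain ⟨a, ha⟩ := corner_subset_range_toDesingHom hp hlim x.2
    exact ⟨a, Subtype.ext ha⟩

end Range

end Ultragraph

theorem proposition6p7 (G : Ultragraph.{u}) (g : G.EmitterListing)
    (w : ℕ → Option G.V) (hw : ∀ v, ∃ i, w i = some v)
    (h : ℕ → Option G.E) (hh : ∀ e, ∃ i, h i = some e) :
    ∃ (p : 𝓜(ℂ, (G.desingularization g).CStar)) (hp : IsStarProjection p),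
      Ultragraph.StrictlyTendsto
        (fun n => (((G.desingularization g).gen.p ((G.initialGenSet w h n).toDesing g) :
          (G.desingularization g).CStar) : 𝓜(ℂ, (G.desingularization g).CStar))) p ∧
      Ultragraph.IsFullCorner p hp ∧
      Nonempty (G.CStar ≃⋆ₐ[ℂ] Ultragraph.corner p hp) := by
  obtain ⟨p, hp, hlim⟩ := Ultragraph.exists_strictlyTendsto_initialProj g hw hh
  exact ⟨p, hp, hlim, Ultragraph.isFullCorner_of_strictlyTendsto hp hlim hw hh,
    Ultragraph.nonempty_starAlgEquiv_corner hp hlim hw hh⟩
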